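/- Let $\mathcal V$ be a cartesian closed category with pullbacks that is extensive, i.e. $\mathcal V$ has all small coproducts and for every small family $(X_i)_{i\in I}$ of objects the functor $\bigsqcup_{i}\colon\prod_{i\in I}\mathcal V/X_i\to\mathcal V/\bigsqcup_{i\in I}X_i$ is an equivalence; write $*$ for its terminal object and $[X,-]$ for its internal homs. Let $\mathcal C$ be a $\mathcal V$-category with a small set of objects. **Definitions.** For an internal category $\mathbb A$ in $\mathcal V$, with object of objects $\mathbb A_0$, object of morphisms $\mathbb A_1$, and source and target maps $s,t\colon\mathbb A_1\to\mathbb A_0$: - $\mathrm{cst}\,X$ denotes the internal category with $X$ as object of objects and object of morphisms and with all structure maps identities; internal functors $\mathrm{cst}\,X\to\mathbb A$ correspond to maps $X\to\mathbb A_0$ in $\mathcal V$, and an *element* of $\mathbb A$ is an internal functor $*=\mathrm{cst}\,{*}\to\mathbb A$. - $\llbracket \mathbb 2,\mathbb A\rrbracket$ denotes the internal category of arrows and commutative squares of $\mathbb A$, with its source-and-target functor $\llbracket\mathbb 2,\mathbb A\rrbracket\to\mathbb A\times\mathbb A$. The *slice* $\mathbb A/T$ over an element $T$ is the pullback of this functor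 along $\mathrm{id}\times T\colon\mathbb A\to\mathbb A\times\mathbb A$, and the *coslice* $I/\mathbb A$ is its pullback along $I\times\mathrm{id}$. The element $T$ is *internal terminal* if the projection $\mathbb A/T\to\mathbb A$ is an isomorphism of internal categories, and $I$ is *internal initial* if the projection $I/\mathbb A\to\mathbb A$ is an isomorphism. - For an internal functor $G\colon\mathrm{cst}\,X\to\mathbb A$, let $G\downarrow\Delta$ be the pullback of $\llbracket\mathbb 2,\llbracket\mathrm{cst}\,X,\mathbb A\rrbracket\rrbracket\to\llbracket\mathrm{cst}\,X,\mathbb A\rrbracket\times\llbracket\mathrm{cst}\,X,\mathbb A\rrbracket$ along $G\times\Delta\colon *\times\mathbb A\to\llbracket\mathrm{cst}\,X,\mathbb A\rrbracket\times\llbracket\mathrm{cst}\,X,\mathbb A\rrbracket$. Here $\llbracket\mathrm{cst}\,X,\mathbb A\rrbracket$ is the internal category with objects of objects and morphisms $[X,\mathbb A_0]$ and $[X,\mathbb A_1]$, and $\Delta$ is the diagonal. An *internal colimit* of $G$ is an internal initial element of $G\downarrow\Delta$. - $\mathrm{Und}\,\mathbb A$ denotes the $\mathcal V$-category whose objects are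 the maps $*\to\mathbb A_0$, with hom-object from $a$ to $b$ the pullback of $(s,t)\colon\mathbb A_1\to\mathbb A_0\times\mathbb A_0$ along $(a,b)\colon *\to\mathbb A_0\times\mathbb A_0$, and with composition and identities induced by those of $\mathbb A$. An object $T$ of a $\mathcal V$-category $\mathcal D$ is *$\mathcal V$-terminal* if $\mathcal D(D,T)\to *$ is an isomorphism for every object $D$. - $\mathrm{Int}\,\mathcal C$ denotes the internal category with $(\mathrm{Int}\,\mathcal C)_0=\bigsqcup_{A\in\mathcal C}*$ and $(\mathrm{Int}\,\mathcal C)_1=\bigsqcup_{A,B\in\mathcal C}\mathcal C(A,B)$, with the structure maps induced by those of $\mathcal C$. - An internal functor $P\colon\mathbb A\to\mathbb B$ is an *internal discrete fibration* if the square with sides $t\colon\mathbb A_1\to\mathbb A_0$, $P_1$, $P_0$, $t\colon\mathbb B_1\to\mathbb B_0$ is a pullback. - For $P\colon\mathbb A\to\mathrm{Int}\,\mathcal C$ and $A\in\mathcal C$, the *fibre* $P^{-1}A$ is the pullback of $P_0$ along the coproduct inclusion $*\to\bigsqcup_{\mathcal C}*$ at $A$. For an object $X$ of $\mathcal V$,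 we say that $\mathbb A$ *has all $\mathcal C$-internal tensors by $X$* if for every $A\in\mathcal C$ and every map $G\colon X\to P^{-1}A$, the internal functor $\mathrm{cst}\,X\to\mathbb A$ corresponding to $X\to P^{-1}A\to\mathbb A_0$ has an internal colimit. - A family $\mathcal G$ of objects of $\mathcal V$ is *conservative* if a map $f\colon Y\to Z$ in $\mathcal V$ is an isomorphism if and only if $f_*\colon\mathcal V(X,Y)\to\mathcal V(X,Z)$ is a bijection for every $X\in\mathcal G$. **Theorem.** Let $\mathcal G$ be a conservative family of objects in $\mathcal V$, and let $P\colon\mathbb A\to\mathrm{Int}\,\mathcal C$ be an internal discrete fibration such that $\mathbb A$ has all $\mathcal C$-internal tensors by every object $X\in\mathcal G$. Let $C\in\mathcal C$ be an object and $x\colon *\to P^{-1}C$ a map in $\mathcal V$, and regard the pair $(C,x)$ as the composite $*\to P^{-1}C\to\mathbb A_0$, that is, as an element of $\mathbb A$ and as an object of $\mathrm{Und}\,\mathbb A$. Then the following are equivalent: 1. $(C,x)$ is an internal terminal object in $\mathbb A$; 2. $(C,x)$ is a $\mathcal V$-terminal object in the underlying $\mathcal V$-category $\mathrm{Und}\,\mathbb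 A$. -/

import Mathlib

open CategoryTheory MonoidalCategory CartesianMonoidalCategory Limits

universe w v u

noncomputable section

set_option linter.unusedSectionVars false

namespace InternalTensors

/-! ### Internal categories -/

section InternalCategories

variable (V : Type u) [Category.{v} V] [HasPullbacks V]

attribute [local simp] pullback.lift_fst pullback.lift_snd pullback.lift_fst_assoc
  pullback.lift_snd_assoc

/-- An internal category in a category `V` with pullbacks. The object `pullback t s` is the
object of composable pairs; its points are pairs `(f, g)` with `t f = s g`, and `c (f, g)` is the
composite "first `f`, then `g`". -/
structure InternalCategory where
  /-- the object of objects -/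
  obj₀ : V
  /-- the object of morphisms -/
  obj₁ : V
  s : obj₁ ⟶ obj₀
  t : obj₁ ⟶ obj₀
  i : obj₀ ⟶ obj₁
  c : pullback t s ⟶ obj₁
  i_s : i ≫ s = 𝟙 obj₀
  i_t : i ≫ t = 𝟙 obj₀
  c_s : c ≫ s = pullback.fst t s ≫ s
  c_t : c ≫ t = pullback.snd t s ≫ t
  unit_left : pullback.lift (s ≫ i) (𝟙 obj₁)
    (by rw [Category.assoc, i_t, Category.comp_id, Category.id_comp]) ≫ c = 𝟙 obj₁
  unit_right : pullback.lift (𝟙 obj₁) (t ≫ i)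
    (by rw [Category.assoc, i_s, Category.comp_id, Category.id_comp]) ≫ c = 𝟙 obj₁
  /-- associativity, on the object of composable triples
  `(obj₁ ×_{obj₀} obj₁) ×_{obj₁} (obj₁ ×_{obj₀} obj₁)` -/
  assoc : pullback.lift
      (pullback.fst (pullback.snd t s) (pullback.fst t s) ≫ c)
      (pullback.snd (pullback.snd t s) (pullback.fst t s) ≫ pullback.snd t s)
      (by rw [Category.assoc, c_t, Category.assoc, ← pullback.condition, ← Category.assoc,
        ← Category.assoc, pullback.condition]) ≫ c =
    pullback.lift
      (pullback.fst (pullback.snd t s) (pullback.fst t s) ≫ pullback.fst t s)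
      (pullback.snd (pullback.snd t s) (pullback.fst t s) ≫ c)
      (by rw [Category.assoc, Category.assoc, c_s, pullback.condition, ← Category.assoc,
        ← Category.assoc, pullback.condition]) ≫ c

variable {V}

namespace InternalCategory

/-- Composition of generalized morphisms `f, g : Y ⟶ A₁` with `t f = s g`. -/
def comp (A : InternalCategory V) {Y : V} (f g : Y ⟶ A.obj₁) (h : f ≫ A.t = g ≫ A.s) :
    Y ⟶ A.obj₁ :=
  pullback.lift f g h ≫ A.c

section

variable (A : InternalCategory V) {Y Z : V}

theorem comp_fst_snd : A.comp (pullback.fst A.t A.s) (pullback.snd A.t A.s) pullback.condition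
    = A.c := by
  have : pullback.lift (pullback.fst A.t A.s) (pullback.snd A.t A.s) pullback.condition
      = 𝟙 _ := by
    apply pullback.hom_ext <;> simp
  rw [comp, this, Category.id_comp]

theorem comp_s (f g : Y ⟶ A.obj₁) (h : f ≫ A.t = g ≫ A.s) : A.comp f g h ≫ A.s = f ≫ A.s := by
  rw [comp, Category.assoc, A.c_s, pullback.lift_fst_assoc]

theorem comp_t (f g : Y ⟶ A.obj₁) (h : f ≫ A.t = g ≫ A.s) : A.comp f g h ≫ A.t = g ≫ A.t := by
  rw [comp, Category.assoc, A.c_t, pullback.lift_snd_assoc]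

theorem precomp (k : Z ⟶ Y) (f g : Y ⟶ A.obj₁) (h : f ≫ A.t = g ≫ A.s) :
    k ≫ A.comp f g h = A.comp (k ≫ f) (k ≫ g)
      (by rw [Category.assoc, Category.assoc, h]) := by
  rw [comp, comp, ← Category.assoc]
  congr 1
  apply pullback.hom_ext <;> simp

theorem c_eq (z : Y ⟶ pullback A.t A.s) : z ≫ A.c =
    A.comp (z ≫ pullback.fst _ _) (z ≫ pullback.snd _ _)
      (by rw [Category.assoc, Category.assoc, pullback.condition]) := by
  rw [← A.precomp z _ _ pullback.condition, comp_fst_snd]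

theorem lift_c (f g : Y ⟶ A.obj₁) (h : f ≫ A.t = g ≫ A.s) :
    pullback.lift f g h ≫ A.c = A.comp f g h := rfl

theorem comp_congr {f f' g g' : Y ⟶ A.obj₁} (h : f ≫ A.t = g ≫ A.s) (hf : f = f') (hg : g = g') :
    A.comp f g h = A.comp f' g' (by rw [← hf, ← hg, h]) := by
  subst hf hg; rfl

theorem id_comp (f : Y ⟶ A.obj₁) (a : Y ⟶ A.obj₀) (h : (a ≫ A.i) ≫ A.t = f ≫ A.s) :
    A.comp (a ≫ A.i) f h = f := by
  have ha : a = f ≫ A.s := by rw [← h, Category.assoc, A.i_t, Category.comp_id]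
  have := congrArg (f ≫ ·) A.unit_left
  simp only [lift_c, precomp, Category.comp_id] at this
  rw [A.comp_congr h (show a ≫ A.i = f ≫ A.s ≫ A.i by rw [ha, Category.assoc]) rfl]
  exact this

theorem comp_id (f : Y ⟶ A.obj₁) (a : Y ⟶ A.obj₀) (h : f ≫ A.t = (a ≫ A.i) ≫ A.s) :
    A.comp f (a ≫ A.i) h = f := by
  have ha : a = f ≫ A.t := by rw [h, Category.assoc, A.i_s, Category.comp_id]
  have := congrArg (f ≫ ·) A.unit_right
  simp only [lift_c, precomp, Category.comp_id] at this
  rw [A.comp_congr h rfl (show a ≫ A.i = f ≫ A.t ≫ A.i by rw [ha, Category.assoc])]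
  exact this

theorem comp_assoc (f g k : Y ⟶ A.obj₁) (h : f ≫ A.t = g ≫ A.s) (h' : g ≫ A.t = k ≫ A.s) :
    A.comp (A.comp f g h) k ((A.comp_t f g h).trans h') =
      A.comp f (A.comp g k h') (h.trans (A.comp_s g k h').symm) := by
  have e := congrArg (pullback.lift (pullback.lift f g h) (pullback.lift g k h')
    (by rw [pullback.lift_fst, pullback.lift_snd]) ≫ ·) A.assoc
  simp only [lift_c, precomp, pullback.lift_fst_assoc, pullback.lift_snd_assoc,
    pullback.lift_fst, pullback.lift_snd] at e
  exact e

end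

/-- Build an internal category from a composition operation on generalized morphisms which is
natural, unital and associative (an application of the Yoneda lemma). The composition map is the
composite of the two projections of the object of composable pairs. -/
abbrev ofElements (obj₀ obj₁ : V) (s t : obj₁ ⟶ obj₀) (i : obj₀ ⟶ obj₁)
    (i_s : i ≫ s = 𝟙 obj₀) (i_t : i ≫ t = 𝟙 obj₀)
    (m : ∀ {Y : V} (f g : Y ⟶ obj₁), f ≫ t = g ≫ s → (Y ⟶ obj₁))
    (m_nat : ∀ {Y Z : V} (k : Z ⟶ Y) (f g : Y ⟶ obj₁) (h : f ≫ t = g ≫ s),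
      k ≫ m f g h = m (k ≫ f) (k ≫ g) (by rw [Category.assoc, Category.assoc, h]))
    (m_s : ∀ {Y : V} (f g : Y ⟶ obj₁) (h : f ≫ t = g ≫ s), m f g h ≫ s = f ≫ s)
    (m_t : ∀ {Y : V} (f g : Y ⟶ obj₁) (h : f ≫ t = g ≫ s), m f g h ≫ t = g ≫ t)
    (id_m : ∀ {Y : V} (f : Y ⟶ obj₁) (h : (f ≫ s ≫ i) ≫ t = f ≫ s), m (f ≫ s ≫ i) f h = f)
    (m_id : ∀ {Y : V} (f : Y ⟶ obj₁) (h : f ≫ t = (f ≫ t ≫ i) ≫ s), m f (f ≫ t ≫ i) h = f)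
    (m_assoc : ∀ {Y : V} (f g k : Y ⟶ obj₁) (h : f ≫ t = g ≫ s) (h' : g ≫ t = k ≫ s),
      m (m f g h) k ((m_t f g h).trans h') = m f (m g k h') (h.trans (m_s g k h').symm)) :
    InternalCategory V where
  obj₀ := obj₀
  obj₁ := obj₁
  s := s
  t := t
  i := i
  c := m (pullback.fst t s) (pullback.snd t s) pullback.condition
  i_s := i_s
  i_t := i_t
  c_s := m_s _ _ _
  c_t := m_t _ _ _
  unit_left := by
    rw [m_nat]
    simp only [pullback.lift_fst, pullback.lift_snd]
    simpa only [Category.id_comp] using id_m (𝟙 obj₁) (by simp [i_t])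
  unit_right := by
    rw [m_nat]
    simp only [pullback.lift_fst, pullback.lift_snd]
    simpa only [Category.id_comp] using m_id (𝟙 obj₁) (by simp [i_s])
  assoc := by
    simp only [m_nat, pullback.lift_fst, pullback.lift_snd]
    have e := pullback.condition (f := pullback.snd t s) (g := pullback.fst t s)
    rw [← m_assoc _ _ _
      (by rw [Category.assoc, pullback.condition (f := t), ← Category.assoc, e])
      (by rw [Category.assoc, Category.assoc, pullback.condition])]
    congr 2

end InternalCategory

/-- An internal functor. -/
@[ext]
structure InternalFunctor (A B : InternalCategory V) where
  f₀ : A.obj₀ ⟶ B.obj₀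
  f₁ : A.obj₁ ⟶ B.obj₁
  map_s : f₁ ≫ B.s = A.s ≫ f₀
  map_t : f₁ ≫ B.t = A.t ≫ f₀
  map_i : A.i ≫ f₁ = f₀ ≫ B.i
  map_c : A.c ≫ f₁ = pullback.lift (pullback.fst A.t A.s ≫ f₁) (pullback.snd A.t A.s ≫ f₁)
    (by rw [Category.assoc, Category.assoc, map_s, map_t, ← Category.assoc, ← Category.assoc,
      pullback.condition]) ≫ B.c

theorem InternalFunctor.map_comp {A B : InternalCategory V} (H : InternalFunctor A B) {Y : V}
    (f g : Y ⟶ A.obj₁) (h : f ≫ A.t = g ≫ A.s) :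
    A.comp f g h ≫ H.f₁ = B.comp (f ≫ H.f₁) (g ≫ H.f₁)
      (by rw [Category.assoc, Category.assoc, H.map_s, H.map_t, ← Category.assoc, h,
        Category.assoc]) := by
  rw [InternalCategory.comp, Category.assoc, H.map_c, InternalCategory.lift_c,
    InternalCategory.precomp]
  simp only [pullback.lift_fst_assoc, pullback.lift_snd_assoc]

/-- Build an internal functor by checking compatibility with composition on generalized
morphisms. -/
abbrev InternalFunctor.ofElements {A B : InternalCategory V} (f₀ : A.obj₀ ⟶ B.obj₀)
    (f₁ : A.obj₁ ⟶ B.obj₁) (map_s : f₁ ≫ B.s = A.s ≫ f₀) (map_t : f₁ ≫ B.t = A.t ≫ f₀)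
    (map_i : A.i ≫ f₁ = f₀ ≫ B.i)
    (map_comp : ∀ {Y : V} (f g : Y ⟶ A.obj₁) (h : f ≫ A.t = g ≫ A.s)
      (h' : (f ≫ f₁) ≫ B.t = (g ≫ f₁) ≫ B.s),
      A.comp f g h ≫ f₁ = B.comp (f ≫ f₁) (g ≫ f₁) h') :
    InternalFunctor A B where
  f₀ := f₀
  f₁ := f₁
  map_s := map_s
  map_t := map_t
  map_i := map_i
  map_c := by
    rw [← A.comp_fst_snd]
    exact map_comp _ _ _ _

/-- The category `Cat(V)` of internal categories and internal functors. -/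
instance : Category (InternalCategory V) where
  Hom A B := InternalFunctor A B
  id A := InternalFunctor.ofElements (𝟙 _) (𝟙 _) (by simp) (by simp) (by simp) (by simp)
  comp H K := InternalFunctor.ofElements (H.f₀ ≫ K.f₀) (H.f₁ ≫ K.f₁)
    (by rw [Category.assoc, K.map_s, ← Category.assoc, H.map_s, Category.assoc])
    (by rw [Category.assoc, K.map_t, ← Category.assoc, H.map_t, Category.assoc])
    (by rw [← Category.assoc, H.map_i, Category.assoc, K.map_i, Category.assoc])
    (fun f g h h' => by
      rw [← Category.assoc, H.map_comp, K.map_comp]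
      simp only [Category.assoc])
  id_comp H := InternalFunctor.ext (Category.id_comp _) (Category.id_comp _)
  comp_id H := InternalFunctor.ext (Category.comp_id _) (Category.comp_id _)
  assoc H K L := InternalFunctor.ext (Category.assoc _ _ _) (Category.assoc _ _ _)

theorem InternalFunctor.comp_f₀ {A B D : InternalCategory V} (H : A ⟶ B) (K : B ⟶ D) :
    (H ≫ K).f₀ = H.f₀ ≫ K.f₀ := rfl

theorem InternalFunctor.comp_f₁ {A B D : InternalCategory V} (H : A ⟶ B) (K : B ⟶ D) :
    (H ≫ K).f₁ = H.f₁ ≫ K.f₁ := rfl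

/-- An internal functor `P : A ⟶ B` is an internal discrete fibration if the square with sides
`t : A₁ ⟶ A₀`, `P₁`, `P₀`, `t : B₁ ⟶ B₀` is a pullback. -/
def IsInternalDiscreteFibration {A B : InternalCategory V} (P : A ⟶ B) : Prop :=
  IsPullback A.t P.f₁ P.f₀ B.t

namespace InternalCategory

/-- The pullback in `Cat(V)` of two internal functors, computed levelwise. -/
abbrev pb {A B D : InternalCategory V} (H : A ⟶ D) (K : B ⟶ D) : InternalCategory V :=
  ofElements (pullback H.f₀ K.f₀) (pullback H.f₁ K.f₁)
    (pullback.map _ _ _ _ A.s B.s D.s H.map_s K.map_s)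
    (pullback.map _ _ _ _ A.t B.t D.t H.map_t K.map_t)
    (pullback.map _ _ _ _ A.i B.i D.i H.map_i.symm K.map_i.symm)
    (by apply pullback.hom_ext <;> simp [A.i_s, B.i_s])
    (by apply pullback.hom_ext <;> simp [A.i_t, B.i_t])
    (fun f g h => pullback.lift
      (A.comp (f ≫ pullback.fst _ _) (g ≫ pullback.fst _ _)
        (by simpa using congrArg (· ≫ pullback.fst _ _) h))
      (B.comp (f ≫ pullback.snd _ _) (g ≫ pullback.snd _ _)
        (by simpa using congrArg (· ≫ pullback.snd _ _) h))
      (by rw [H.map_comp, K.map_comp]; simp only [Category.assoc, pullback.condition]))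
    (fun k f g h => by apply pullback.hom_ext <;> simp [precomp])
    (fun f g h => by apply pullback.hom_ext <;> simp [comp_s])
    (fun f g h => by apply pullback.hom_ext <;> simp [comp_t])
    (fun f h => by
      apply pullback.hom_ext
      · rw [pullback.lift_fst]
        exact (A.comp_congr _ (by simp) rfl).trans (A.id_comp _ (f ≫ pullback.fst _ _ ≫ A.s)
          (by simp [A.i_t]))
      · rw [pullback.lift_snd]
        exact (B.comp_congr _ (by simp) rfl).trans (B.id_comp _ (f ≫ pullback.snd _ _ ≫ B.s)
          (by simp [B.i_t])))
    (fun f h => by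
      apply pullback.hom_ext
      · rw [pullback.lift_fst]
        exact (A.comp_congr _ rfl (by simp)).trans (A.comp_id _ (f ≫ pullback.fst _ _ ≫ A.t)
          (by simp [A.i_s]))
      · rw [pullback.lift_snd]
        exact (B.comp_congr _ rfl (by simp)).trans (B.comp_id _ (f ≫ pullback.snd _ _ ≫ B.t)
          (by simp [B.i_s])))
    (fun f g k h h' => by
      apply pullback.hom_ext
      · simp only [pullback.lift_fst]
        exact A.comp_assoc _ _ _ _ _
      · simp only [pullback.lift_snd]
        exact B.comp_assoc _ _ _ _ _)

/-- The first projection out of a pullback in `Cat(V)`. -/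
abbrev pbFst {A B D : InternalCategory V} (H : A ⟶ D) (K : B ⟶ D) : pb H K ⟶ A :=
  InternalFunctor.ofElements (pullback.fst _ _) (pullback.fst _ _)
    (pullback.lift_fst _ _ _).symm (pullback.lift_fst _ _ _).symm (pullback.lift_fst _ _ _)
    (fun f g h h' => by
      change (pullback.lift f g h ≫ pullback.lift _ _ _) ≫ pullback.fst _ _ = _
      rw [Category.assoc, pullback.lift_fst, precomp]
      exact A.comp_congr _ (by rw [pullback.lift_fst_assoc]) (by rw [pullback.lift_snd_assoc]))

/-- The second projection out of a pullback in `Cat(V)`. -/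
abbrev pbSnd {A B D : InternalCategory V} (H : A ⟶ D) (K : B ⟶ D) : pb H K ⟶ B :=
  InternalFunctor.ofElements (pullback.snd _ _) (pullback.snd _ _)
    (pullback.lift_snd _ _ _).symm (pullback.lift_snd _ _ _).symm (pullback.lift_snd _ _ _)
    (fun f g h h' => by
      change (pullback.lift f g h ≫ pullback.lift _ _ _) ≫ pullback.snd _ _ = _
      rw [Category.assoc, pullback.lift_snd, precomp]
      exact B.comp_congr _ (by rw [pullback.lift_fst_assoc]) (by rw [pullback.lift_snd_assoc]))

/-- The square defining `pb` is a pullback square in `Cat(V)`. -/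
theorem isPullback_pb {A B D : InternalCategory V} (H : A ⟶ D) (K : B ⟶ D) :
    IsPullback (pbFst H K) (pbSnd H K) H K where
  w := InternalFunctor.ext pullback.condition pullback.condition
  isLimit' := ⟨PullbackCone.IsLimit.mk _
    (fun c => InternalFunctor.ofElements
      (pullback.lift c.fst.f₀ c.snd.f₀
        (by rw [← InternalFunctor.comp_f₀, c.condition, InternalFunctor.comp_f₀]))
      (pullback.lift c.fst.f₁ c.snd.f₁
        (by rw [← InternalFunctor.comp_f₁, c.condition, InternalFunctor.comp_f₁]))
      (by
        apply pullback.hom_ext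
        · simp [pb, ofElements, InternalFunctor.map_s]
        · simp [pb, ofElements, InternalFunctor.map_s])
      (by
        apply pullback.hom_ext
        · simp [pb, ofElements, InternalFunctor.map_t]
        · simp [pb, ofElements, InternalFunctor.map_t])
      (by
        apply pullback.hom_ext
        · simp [pb, ofElements, InternalFunctor.map_i]
        · simp [pb, ofElements, InternalFunctor.map_i])
      (fun f g h h' => by
        apply pullback.hom_ext
        · rw [Category.assoc, pullback.lift_fst, InternalFunctor.map_comp]
          refine Eq.trans ?_ ((pbFst H K).map_comp _ _ h').symm
          exact A.comp_congr _ (by simp)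
            (by simp)
        · rw [Category.assoc, pullback.lift_snd, InternalFunctor.map_comp]
          refine Eq.trans ?_ ((pbSnd H K).map_comp _ _ h').symm
          exact B.comp_congr _ (by simp)
            (by simp)))
    (fun c => InternalFunctor.ext (pullback.lift_fst _ _ _) (pullback.lift_fst _ _ _))
    (fun c => InternalFunctor.ext (pullback.lift_snd _ _ _) (pullback.lift_snd _ _ _))
    (fun c m h₁ h₂ => InternalFunctor.ext
      (pullback.hom_ext
        ((congrArg InternalFunctor.f₀ h₁).trans (pullback.lift_fst _ _ _).symm)
        ((congrArg InternalFunctor.f₀ h₂).trans (pullback.lift_snd _ _ _).symm))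
      (pullback.hom_ext
        ((congrArg InternalFunctor.f₁ h₁).trans (pullback.lift_fst _ _ _).symm)
        ((congrArg InternalFunctor.f₁ h₂).trans (pullback.lift_snd _ _ _).symm)))⟩

/-- The constant internal category `cst X`. -/
abbrev cst (X : V) : InternalCategory V :=
  ofElements X X (𝟙 X) (𝟙 X) (𝟙 X) (by simp) (by simp) (fun f _ _ => f)
    (fun _ _ _ _ => rfl) (fun _ _ _ => rfl) (fun _ _ h => h) (by simp) (by simp)
    (fun _ _ _ _ _ => rfl)

/-- The internal functor `cst X ⟶ A` corresponding to a map `X ⟶ A₀`. -/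
def cstDesc {X : V} {A : InternalCategory V} (g : X ⟶ A.obj₀) : cst X ⟶ A :=
  InternalFunctor.ofElements g (g ≫ A.i)
    (by simp [cst, ofElements, A.i_s]) (by simp [cst, ofElements, A.i_t])
    (Category.id_comp _)
    (fun f k h h' => by
      have e : f = k := by simpa [cst, ofElements] using h
      subst e
      have : (cst X).comp f f h = f := by simp [cst, comp, ofElements]
      rw [this]
      exact ((A.comp_congr _ (Category.assoc _ _ _).symm rfl).trans
        (A.id_comp _ (f ≫ g) (by simp [A.i_s, A.i_t]))).symm)

end InternalCategory

end InternalCategories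

/-! ### Slices and categories of cocones -/

section Squares

variable {V : Type u} [Category.{v} V] [HasPullbacks V]

attribute [local simp] pullback.lift_fst pullback.lift_snd pullback.lift_fst_assoc
  pullback.lift_snd_assoc

namespace InternalCategory

/-- The object of commutative squares of `A`: its points are `((u, q), (p, v))` with `u` followed
by `q` equal to `p` followed by `v`. Such a square is a morphism `(p, q)` from the arrow `u` to
the arrow `v`. -/
abbrev sq (A : InternalCategory V) : V := pullback A.c A.c

variable (A : InternalCategory V)

/-- The side `u` of a square. -/
def sqU : A.sq ⟶ A.obj₁ := pullback.fst A.c A.c ≫ pullback.fst A.t A.s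

/-- The side `q` of a square. -/
def sqQ : A.sq ⟶ A.obj₁ := pullback.fst A.c A.c ≫ pullback.snd A.t A.s

/-- The side `p` of a square. -/
def sqP : A.sq ⟶ A.obj₁ := pullback.snd A.c A.c ≫ pullback.fst A.t A.s

/-- The side `v` of a square. -/
def sqV : A.sq ⟶ A.obj₁ := pullback.snd A.c A.c ≫ pullback.snd A.t A.s

variable {Y Z : V}

theorem sq_uq (y : Y ⟶ A.sq) : (y ≫ A.sqU) ≫ A.t = (y ≫ A.sqQ) ≫ A.s := by
  simp only [Category.assoc, pullback.condition, sqU, sqQ]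

theorem sq_pv (y : Y ⟶ A.sq) : (y ≫ A.sqP) ≫ A.t = (y ≫ A.sqV) ≫ A.s := by
  simp only [Category.assoc, pullback.condition, sqP, sqV]

theorem sq_comm (y : Y ⟶ A.sq) : A.comp (y ≫ A.sqU) (y ≫ A.sqQ) (A.sq_uq y) =
    A.comp (y ≫ A.sqP) (y ≫ A.sqV) (A.sq_pv y) := by
  have h : pullback.fst A.c A.c ≫ A.c = pullback.snd A.c A.c ≫ A.c := pullback.condition
  rw [c_eq, c_eq] at h
  have h' := congrArg (y ≫ ·) h
  simp only [precomp] at h'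
  exact h'

theorem sq_s (y : Y ⟶ A.sq) : (y ≫ A.sqU) ≫ A.s = (y ≫ A.sqP) ≫ A.s := by
  rw [← A.comp_s _ _ (A.sq_uq y), A.sq_comm, A.comp_s]

theorem sq_t (y : Y ⟶ A.sq) : (y ≫ A.sqQ) ≫ A.t = (y ≫ A.sqV) ≫ A.t := by
  rw [← A.comp_t _ _ (A.sq_uq y), A.sq_comm, A.comp_t]

/-- The generalized commutative square with sides `u, q, p, v`. -/
def sqLift (u q p v : Y ⟶ A.obj₁) (h₁ : u ≫ A.t = q ≫ A.s) (h₂ : p ≫ A.t = v ≫ A.s)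
    (h : A.comp u q h₁ = A.comp p v h₂) : Y ⟶ A.sq :=
  pullback.lift (pullback.lift u q h₁) (pullback.lift p v h₂) (by rw [lift_c, lift_c, h])

section

variable (u q p v : Y ⟶ A.obj₁) (h₁ : u ≫ A.t = q ≫ A.s) (h₂ : p ≫ A.t = v ≫ A.s)
    (h : A.comp u q h₁ = A.comp p v h₂)

theorem sqLift_sqU : A.sqLift u q p v h₁ h₂ h ≫ A.sqU = u := by
  rw [sqLift, sqU, pullback.lift_fst_assoc, pullback.lift_fst]

theorem sqLift_sqQ : A.sqLift u q p v h₁ h₂ h ≫ A.sqQ = q := by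
  rw [sqLift, sqQ, pullback.lift_fst_assoc, pullback.lift_snd]

theorem sqLift_sqP : A.sqLift u q p v h₁ h₂ h ≫ A.sqP = p := by
  rw [sqLift, sqP, pullback.lift_snd_assoc, pullback.lift_fst]

theorem sqLift_sqV : A.sqLift u q p v h₁ h₂ h ≫ A.sqV = v := by
  rw [sqLift, sqV, pullback.lift_snd_assoc, pullback.lift_snd]

end

variable {A} in
theorem sq_ext {y z : Y ⟶ A.sq} (hu : y ≫ A.sqU = z ≫ A.sqU) (hq : y ≫ A.sqQ = z ≫ A.sqQ)
    (hp : y ≫ A.sqP = z ≫ A.sqP) (hv : y ≫ A.sqV = z ≫ A.sqV) : y = z := by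
  apply pullback.hom_ext <;> apply pullback.hom_ext <;> simp only [Category.assoc]
  · exact hu
  · exact hq
  · exact hp
  · exact hv

/-- Pasting of generalized squares `f` and `g`, where the target arrow of `f` is the source arrow
of `g`. -/
def sqComp (f g : Y ⟶ A.sq) (h : f ≫ A.sqV = g ≫ A.sqU) : Y ⟶ A.sq :=
  A.sqLift (f ≫ A.sqU)
    (A.comp (f ≫ A.sqQ) (g ≫ A.sqQ) (by rw [A.sq_t, h, A.sq_uq]))
    (A.comp (f ≫ A.sqP) (g ≫ A.sqP) (by rw [A.sq_pv, h, A.sq_s]))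
    (g ≫ A.sqV)
    (by rw [A.comp_s, A.sq_uq]) (by rw [A.comp_t, A.sq_pv])
    (by
      rw [← A.comp_assoc _ _ _ (A.sq_uq f), A.comp_congr _ (A.sq_comm f) rfl,
        A.comp_assoc _ _ _ (A.sq_pv f) (by rw [h, A.sq_uq]),
        A.comp_assoc _ _ _ _ (A.sq_pv g)]
      exact A.comp_congr _ rfl ((A.comp_congr _ h rfl).trans (A.sq_comm g)))

/-- The identity square of an arrow. -/
def sqId : A.obj₁ ⟶ A.sq :=
  A.sqLift (𝟙 _) (A.t ≫ A.i) (A.s ≫ A.i) (𝟙 _) (by simp [A.i_s]) (by simp [A.i_t])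
    (by rw [A.comp_id _ A.t, A.id_comp _ A.s])

theorem sqId_sqP : A.sqId ≫ A.sqP = A.s ≫ A.i := by
  rw [sqId, sqLift_sqP]

theorem sqId_sqQ : A.sqId ≫ A.sqQ = A.t ≫ A.i := by
  rw [sqId, sqLift_sqQ]

theorem sqComp_precomp (k : Z ⟶ Y) (f g : Y ⟶ A.sq) (h : f ≫ A.sqV = g ≫ A.sqU) :
    k ≫ A.sqComp f g h = A.sqComp (k ≫ f) (k ≫ g)
      (by rw [Category.assoc, Category.assoc, h]) := by
  apply sq_ext <;> rw [Category.assoc] <;>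
    simp only [sqComp, sqLift_sqU, sqLift_sqQ, sqLift_sqP, sqLift_sqV, precomp, Category.assoc]

/-- The internal category of arrows `⟦𝟚, A⟧`: its object of objects is `A₁`, its object of
morphisms is the object of commutative squares, and squares compose by pasting. -/
abbrev arrow : InternalCategory V :=
  ofElements A.obj₁ A.sq A.sqU A.sqV A.sqId (A.sqLift_sqU _ _ _ _ _ _ _)
    (A.sqLift_sqV _ _ _ _ _ _ _)
    (fun f g h => A.sqComp f g h)
    A.sqComp_precomp
    (fun f g h => A.sqLift_sqU _ _ _ _ _ _ _)
    (fun f g h => A.sqLift_sqV _ _ _ _ _ _ _)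
    (fun f h => by
      apply sq_ext
      · simp only [sqComp, sqLift_sqU, sqId, Category.assoc, Category.comp_id]
      · simp only [sqComp, sqLift_sqQ, sqId, Category.assoc]
        refine (A.comp_congr _ (f' := (f ≫ A.sqU ≫ A.t) ≫ A.i) ?_ rfl).trans
          (A.id_comp _ _ ?_)
        · simp only [Category.assoc]
        · rw [Category.assoc, A.i_t, Category.comp_id, ← A.sq_uq, Category.assoc]
      · simp only [sqComp, sqLift_sqP, sqId, Category.assoc]
        refine (A.comp_congr _ (f' := (f ≫ A.sqU ≫ A.s) ≫ A.i) ?_ rfl).trans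
          (A.id_comp _ _ ?_)
        · simp only [Category.assoc]
        · rw [Category.assoc, A.i_t, Category.comp_id, ← A.sq_s, Category.assoc]
      · simp only [sqComp, sqLift_sqV])
    (fun f h => by
      apply sq_ext
      · simp only [sqComp, sqLift_sqU]
      · simp only [sqComp, sqLift_sqQ, sqId, Category.assoc]
        refine (A.comp_congr _ (g' := (f ≫ A.sqV ≫ A.t) ≫ A.i) rfl ?_).trans
          (A.comp_id _ _ ?_)
        · simp only [Category.assoc]
        · rw [Category.assoc _ A.i, A.i_s, Category.comp_id, A.sq_t, Category.assoc]
      · simp only [sqComp, sqLift_sqP, sqId, Category.assoc]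
        refine (A.comp_congr _ (g' := (f ≫ A.sqV ≫ A.s) ≫ A.i) rfl ?_).trans
          (A.comp_id _ _ ?_)
        · simp only [Category.assoc]
        · rw [Category.assoc _ A.i, A.i_s, Category.comp_id, A.sq_pv, Category.assoc]
      · simp only [sqComp, sqLift_sqV, sqId, Category.assoc, Category.comp_id])
    (fun f g k h h' => by
      apply sq_ext
      · simp only [sqComp, sqLift_sqU]
      · simp only [sqComp, sqLift_sqQ]
        exact A.comp_assoc _ _ _ _ _
      · simp only [sqComp, sqLift_sqP]
        exact A.comp_assoc _ _ _ _ _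
      · simp only [sqComp, sqLift_sqV])

/-- The internal functor `⟨0⟩^* : ⟦𝟚, A⟧ ⟶ A` sending an arrow to its source. -/
abbrev dom : arrow A ⟶ A :=
  InternalFunctor.ofElements A.s A.sqP
    (by simpa using (A.sq_s (𝟙 _)).symm) (by simpa using A.sq_pv (𝟙 _)) A.sqId_sqP
    (fun f g h h' => by
      refine (Category.assoc (pullback.lift f g h) (A.sqComp _ _ pullback.condition) A.sqP).trans ?_
      rw [sqComp, sqLift_sqP, precomp]
      exact A.comp_congr _ (by simp) (by simp))

/-- The internal functor `⟨1⟩^* : ⟦𝟚, A⟧ ⟶ A` sending an arrow to its target. -/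
abbrev cod : arrow A ⟶ A :=
  InternalFunctor.ofElements A.t A.sqQ
    (by simpa using (A.sq_uq (𝟙 _)).symm) (by simpa using A.sq_t (𝟙 _)) A.sqId_sqQ
    (fun f g h h' => by
      refine (Category.assoc (pullback.lift f g h) (A.sqComp _ _ pullback.condition) A.sqQ).trans ?_
      rw [sqComp, sqLift_sqQ, precomp]
      exact A.comp_congr _ (by simp) (by simp))

end InternalCategory

end Squares

section Slices

variable {V : Type u} [Category.{v} V] [CartesianMonoidalCategory V] [HasPullbacks V]

attribute [local simp] pullback.lift_fst pullback.lift_snd pullback.lift_fst_assoc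
  pullback.lift_snd_assoc

namespace InternalCategory

/-- The product `A × B` in `Cat(V)`, computed levelwise. -/
abbrev prod (A B : InternalCategory V) : InternalCategory V :=
  ofElements (A.obj₀ ⊗ B.obj₀) (A.obj₁ ⊗ B.obj₁) (A.s ⊗ₘ B.s) (A.t ⊗ₘ B.t) (A.i ⊗ₘ B.i)
    (by simp [A.i_s, B.i_s]) (by simp [A.i_t, B.i_t])
    (fun f g h => lift
      (A.comp (f ≫ fst _ _) (g ≫ fst _ _) (by simpa using congrArg (· ≫ fst _ _) h))
      (B.comp (f ≫ snd _ _) (g ≫ snd _ _) (by simpa using congrArg (· ≫ snd _ _) h)))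
    (fun k f g h => by simp [comp_lift, precomp])
    (fun f g h => by apply CartesianMonoidalCategory.hom_ext <;> simp [comp_s])
    (fun f g h => by apply CartesianMonoidalCategory.hom_ext <;> simp [comp_t])
    (fun f h => by
      apply CartesianMonoidalCategory.hom_ext
      · rw [lift_fst]
        exact (A.comp_congr _ (by simp) rfl).trans (A.id_comp _ (f ≫ fst _ _ ≫ A.s)
          (by simp [A.i_t]))
      · rw [lift_snd]
        exact (B.comp_congr _ (by simp) rfl).trans (B.id_comp _ (f ≫ snd _ _ ≫ B.s)
          (by simp [B.i_t])))
    (fun f h => by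
      apply CartesianMonoidalCategory.hom_ext
      · rw [lift_fst]
        exact (A.comp_congr _ rfl (by simp)).trans (A.comp_id _ (f ≫ fst _ _ ≫ A.t)
          (by simp [A.i_s]))
      · rw [lift_snd]
        exact (B.comp_congr _ rfl (by simp)).trans (B.comp_id _ (f ≫ snd _ _ ≫ B.t)
          (by simp [B.i_s])))
    (fun f g k h h' => by
      apply CartesianMonoidalCategory.hom_ext
      · simp only [lift_fst]
        exact A.comp_assoc _ _ _ _ _
      · simp only [lift_snd]
        exact B.comp_assoc _ _ _ _ _)

/-- The internal functor `(H, K) : D ⟶ A × B`. -/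
abbrev prodLift {A B D : InternalCategory V} (H : D ⟶ A) (K : D ⟶ B) : D ⟶ prod A B :=
  InternalFunctor.ofElements (lift H.f₀ K.f₀) (lift H.f₁ K.f₁)
    (by apply CartesianMonoidalCategory.hom_ext <;> simp [InternalFunctor.map_s])
    (by apply CartesianMonoidalCategory.hom_ext <;> simp [InternalFunctor.map_t])
    (by apply CartesianMonoidalCategory.hom_ext <;> simp [InternalFunctor.map_i])
    (fun f g h h' => by
      apply CartesianMonoidalCategory.hom_ext
      · rw [Category.assoc, lift_fst, H.map_comp]
        refine Eq.trans ?_ (Category.assoc (pullback.lift _ _ h') (lift _ _) (fst _ _)).symm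
        rw [lift_fst, precomp]
        exact A.comp_congr _ (by simp) (by simp)
      · rw [Category.assoc, lift_snd, K.map_comp]
        refine Eq.trans ?_ (Category.assoc (pullback.lift _ _ h') (lift _ _) (snd _ _)).symm
        rw [lift_snd, precomp]
        exact B.comp_congr _ (by simp) (by simp))

/-- The unique internal functor to the terminal internal category `cst *`. -/
abbrev toTerminal (A : InternalCategory V) : A ⟶ cst (𝟙_ V) :=
  InternalFunctor.ofElements (toUnit _) (toUnit _) (toUnit_unique _ _) (toUnit_unique _ _)
    (toUnit_unique _ _) (fun _ _ _ _ => toUnit_unique _ _)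

/-- The internal functor `⟨0, 1⟩^* : ⟦𝟚, A⟧ ⟶ A × A` sending an arrow to its source and
target. -/
abbrev endpoints (A : InternalCategory V) : arrow A ⟶ prod A A :=
  prodLift (dom A) (cod A)

/-- An element of `A`: an internal functor `* ⟶ A`. -/
abbrev Element (A : InternalCategory V) := cst (𝟙_ V) ⟶ A

/-- The slice `A / T`: the pullback of `⟦𝟚, A⟧ ⟶ A × A` along `id × T : A ⟶ A × A`. -/
abbrev slice (A : InternalCategory V) (T : A.Element) : InternalCategory V :=
  pb (prodLift (𝟙 A) (toTerminal A ≫ T)) (endpoints A)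

/-- The projection `A / T ⟶ A`. -/
abbrev sliceProj (A : InternalCategory V) (T : A.Element) : slice A T ⟶ A :=
  pbFst _ _

/-- The coslice `I / A`: the pullback of `⟦𝟚, A⟧ ⟶ A × A` along `I × id : A ⟶ A × A`. -/
abbrev coslice (A : InternalCategory V) (I : A.Element) : InternalCategory V :=
  pb (prodLift (toTerminal A ≫ I) (𝟙 A)) (endpoints A)

/-- The projection `I / A ⟶ A`. -/
abbrev cosliceProj (A : InternalCategory V) (I : A.Element) : coslice A I ⟶ A :=
  pbFst _ _

/-- An element `T` is an internal terminal object if the projection `A / T ⟶ A` is an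
isomorphism of internal categories. -/
def IsInternalTerminal (A : InternalCategory V) (T : A.Element) : Prop :=
  IsIso (sliceProj A T)

/-- An element `I` is an internal initial object if the projection `I / A ⟶ A` is an
isomorphism of internal categories. -/
def IsInternalInitial (A : InternalCategory V) (I : A.Element) : Prop :=
  IsIso (cosliceProj A I)

section Cocones

variable [MonoidalClosed V]

open MonoidalClosed

/-- The internal category `⟦cst X, A⟧`, whose objects of objects and morphisms are `[X, A₀]` and
`[X, A₁]`, with structure maps induced by those of `A`. Composition is the transpose of
composition in `A`. -/
abbrev homCst (X : V) (A : InternalCategory V) : InternalCategory V :=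
  ofElements ((ihom X).obj A.obj₀) ((ihom X).obj A.obj₁) ((ihom X).map A.s) ((ihom X).map A.t)
    ((ihom X).map A.i)
    (by rw [← Functor.map_comp, A.i_s, CategoryTheory.Functor.map_id])
    (by rw [← Functor.map_comp, A.i_t, CategoryTheory.Functor.map_id])
    (fun f g h => curry (A.comp (uncurry f) (uncurry g)
      (by rw [← uncurry_natural_right, h, uncurry_natural_right])))
    (fun k f g h => by
      rw [← curry_natural_left, precomp]
      congr 1
      exact A.comp_congr _ (uncurry_natural_left _ _).symm (uncurry_natural_left _ _).symm)
    (fun f g h => by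
      rw [← curry_natural_right, comp_s, curry_natural_right, curry_uncurry])
    (fun f g h => by
      rw [← curry_natural_right, comp_t, curry_natural_right, curry_uncurry])
    (fun f h => by
      rw [curry_eq_iff]
      exact (A.comp_congr _ (f' := (uncurry f ≫ A.s) ≫ A.i)
        (by rw [← Functor.map_comp, uncurry_natural_right, Category.assoc]) rfl).trans
        (A.id_comp _ _ (by simp [A.i_t])))
    (fun f h => by
      rw [curry_eq_iff]
      exact (A.comp_congr _ (g' := (uncurry f ≫ A.t) ≫ A.i) rfl
        (by rw [← Functor.map_comp, uncurry_natural_right, Category.assoc])).trans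
        (A.comp_id _ _ (by simp [A.i_s])))
    (fun f g k h h' => by
      congr 1
      simp only [uncurry_curry]
      exact A.comp_assoc _ _ _ _ _)

/-- The diagonal `Δ : A ⟶ ⟦cst X, A⟧`. -/
abbrev diag (X : V) (A : InternalCategory V) : A ⟶ homCst X A :=
  InternalFunctor.ofElements (curry (snd X A.obj₀)) (curry (snd X A.obj₁))
    (by rw [← curry_natural_right, ← curry_natural_left, whiskerLeft_snd])
    (by rw [← curry_natural_right, ← curry_natural_left, whiskerLeft_snd])
    (by rw [← curry_natural_right, ← curry_natural_left, whiskerLeft_snd])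
    (fun f g h h' => by
      change _ = pullback.lift _ _ h' ≫ curry (A.comp _ _ _)
      rw [← curry_natural_left, ← curry_natural_left, whiskerLeft_snd, precomp, precomp]
      congr 1
      refine A.comp_congr _ ?_ ?_
      · rw [← uncurry_natural_left, pullback.lift_fst, uncurry_natural_left, uncurry_curry,
          whiskerLeft_snd]
      · rw [← uncurry_natural_left, pullback.lift_snd, uncurry_natural_left, uncurry_curry,
          whiskerLeft_snd])

/-- An internal functor `G : cst X ⟶ A` regarded as an element `* ⟶ ⟦cst X, A⟧`. -/
abbrev name {X : V} {A : InternalCategory V} (G : cst X ⟶ A) : (homCst X A).Element :=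
  cstDesc (curry (fst X (𝟙_ V) ≫ G.f₀))

/-- The internal category `G ↓ Δ` of cocones under `G : cst X ⟶ A`: the pullback of
`⟦𝟚, ⟦cst X, A⟧⟧ ⟶ ⟦cst X, A⟧ × ⟦cst X, A⟧` along `G × Δ`. -/
abbrev cocones {X : V} {A : InternalCategory V} (G : cst X ⟶ A) : InternalCategory V :=
  pb (prodLift (toTerminal A ≫ name G) (diag X A)) (endpoints (homCst X A))

/-- An internal colimit of `G : cst X ⟶ A` is an internal initial object of `G ↓ Δ`. -/
def IsInternalColimit {X : V} {A : InternalCategory V} (G : cst X ⟶ A)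
    (e : (cocones G).Element) : Prop :=
  IsInternalInitial (cocones G) e

end Cocones

end InternalCategory

end Slices

/-! ### Extensive categories -/

section Extensive

variable (V : Type u) [Category.{v} V]

variable {V} in
/-- The functor `∏ i, V / X i ⟶ V / ∐ X` sending a family `Y i ⟶ X i` to `∐ Y ⟶ ∐ X`. -/
abbrev sigmaOver [HasCoproducts.{w} V] {I : Type w} (X : I → V) :
    (∀ i, Over (X i)) ⥤ Over (∐ X) where
  obj Y := Over.mk (Limits.Sigma.map fun i => (Y i).hom)
  map g := Over.homMk (Limits.Sigma.map fun i => (g i).left) (by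
    apply Limits.Sigma.hom_ext
    intro i
    simp)
  map_id Y := by
    apply Over.OverMorphism.ext
    apply Limits.Sigma.hom_ext
    intro i
    simp
  map_comp g k := by
    apply Over.OverMorphism.ext
    apply Limits.Sigma.hom_ext
    intro i
    simp

/-- A category is extensive if it has small coproducts and for every small family of objects `X`
the functor `∏ i, V / X i ⟶ V / ∐ X` is an equivalence. Here "small" means indexed by a type in
the universe `w`. -/
class Extensive : Prop where
  [hasCoproducts : HasCoproducts.{w} V]
  isEquivalence : ∀ {I : Type w} (X : I → V), (sigmaOver X).IsEquivalence

instance [Extensive.{w} V] (I : Type w) : HasColimitsOfShape (Discrete I) V :=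
  Extensive.hasCoproducts I

instance [Extensive.{w} V] {I : Type w} (X : I → V) : (sigmaOver X).IsEquivalence :=
  Extensive.isEquivalence X

variable {V} [Extensive.{w} V] [HasPullbacks V] {I : Type w}

attribute [local simp] pullback.lift_fst pullback.lift_snd pullback.lift_fst_assoc
  pullback.lift_snd_assoc

/-- The right adjoint of `sigmaOver`, given by pulling back along the coproduct inclusions. -/
abbrev overSigma (X : I → V) : Over (∐ X) ⥤ ∀ i, Over (X i) where
  obj f := fun i => Over.mk (pullback.snd f.hom (Limits.Sigma.ι X i))
  map {f g} a := fun i => Over.homMk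
    (pullback.lift (pullback.fst f.hom (Limits.Sigma.ι X i) ≫ a.left)
      (pullback.snd f.hom (Limits.Sigma.ι X i)) (by simp [pullback.condition])) (by simp)
  map_id f := by
    funext i
    apply Over.OverMorphism.ext
    change pullback.lift _ _ _ = 𝟙 (pullback _ _)
    apply pullback.hom_ext <;> simp
  map_comp a b := by
    funext i
    apply Over.OverMorphism.ext
    change pullback.lift _ _ _ =
      pullback.lift _ _ _ ≫ pullback.lift _ _ _
    apply pullback.hom_ext <;> simp

/-- The unit of the adjunction between `sigmaOver` and `overSigma`. -/
def sigmaOverUnit (X : I → V) : 𝟭 (∀ i, Over (X i)) ⟶ sigmaOver X ⋙ overSigma X where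
  app Y := fun i => Over.homMk (U := Y i)
    (V := Over.mk (pullback.snd (Limits.Sigma.map fun i => (Y i).hom) (Limits.Sigma.ι X i)))
    (pullback.lift (Limits.Sigma.ι (fun i => (Y i).left) i) (Y i).hom (by simp))
    (by simp)
  naturality Y Z g := by
    funext i
    apply Over.OverMorphism.ext
    change (g i).left ≫ pullback.lift _ _ _ = pullback.lift _ _ _ ≫ pullback.lift _ _ _
    apply pullback.hom_ext <;> simp

/-- The counit of the adjunction between `sigmaOver` and `overSigma`. -/
def sigmaOverCounit (X : I → V) : overSigma X ⋙ sigmaOver X ⟶ 𝟭 (Over (∐ X)) where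
  app g := Over.homMk
    (U := Over.mk (Limits.Sigma.map fun i => pullback.snd g.hom (Limits.Sigma.ι X i)))
    (Limits.Sigma.desc fun i => pullback.fst g.hom (Limits.Sigma.ι X i)) (by
      apply Limits.Sigma.hom_ext
      intro i
      simp [pullback.condition])
  naturality g k a := by
    apply Over.OverMorphism.ext
    change Limits.Sigma.map (fun i => pullback.lift
        (pullback.fst g.hom (Limits.Sigma.ι X i) ≫ a.left) (pullback.snd g.hom (Limits.Sigma.ι X i))
        (by simp [pullback.condition])) ≫
      Limits.Sigma.desc (fun i => pullback.fst k.hom (Limits.Sigma.ι X i)) =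
        Limits.Sigma.desc (fun i => pullback.fst g.hom (Limits.Sigma.ι X i)) ≫ a.left
    apply Limits.Sigma.hom_ext
    intro i
    simp

/-- The adjunction between `sigmaOver` and `overSigma`. -/
def sigmaOverAdj (X : I → V) : sigmaOver X ⊣ overSigma X :=
  Adjunction.mkOfUnitCounit
    { unit := sigmaOverUnit X
      counit := sigmaOverCounit X
      left_triangle := by
        ext1
        funext Y
        apply Over.OverMorphism.ext
        change Limits.Sigma.map (fun i => pullback.lift (Limits.Sigma.ι (fun i => (Y i).left) i)
            (Y i).hom (by simp)) ≫ 𝟙 _ ≫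
          Limits.Sigma.desc (fun i => pullback.fst (Limits.Sigma.map fun i => (Y i).hom)
            (Limits.Sigma.ι X i)) = 𝟙 (∐ fun i => (Y i).left)
        apply Limits.Sigma.hom_ext
        intro i
        simp
      right_triangle := by
        ext1
        funext g i
        apply Over.OverMorphism.ext
        change pullback.lift _ _ _ ≫ 𝟙 _ ≫ pullback.lift (_ ≫ Limits.Sigma.desc _) _ _ =
          𝟙 (pullback _ _)
        apply pullback.hom_ext <;> simp }

theorem isPullback_sigma {X Y : I → V} (g : ∀ i, Y i ⟶ X i) (i : I) :
    IsPullback (Limits.Sigma.ι Y i) (g i) (Limits.Sigma.map g) (Limits.Sigma.ι X i) := by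
  let F : ∀ i, Over (X i) := fun i => Over.mk (g i)
  have h : IsIso ((sigmaOverAdj X).unit.app F) := inferInstance
  have h' : IsIso (pullback.lift (Limits.Sigma.ι Y i) (g i) (by simp) :
      Y i ⟶ pullback (Limits.Sigma.map g) (Limits.Sigma.ι X i)) :=
    inferInstanceAs (IsIso ((Over.forget _).map ((Pi.eval (fun i => Over (X i)) i).map
      ((sigmaOverAdj X).unit.app F))))
  exact IsPullback.of_iso_pullback ⟨Limits.Sigma.ι_map _ _⟩ (@asIso _ _ _ _ _ h') (by simp)
    (by simp)

theorem isColimit_pullback {X : I → V} {Y : V} (f : Y ⟶ ∐ X) :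
    Nonempty (IsColimit (Cofan.mk Y fun i => pullback.fst f (Limits.Sigma.ι X i))) := by
  have h : IsIso ((sigmaOverAdj X).counit.app (Over.mk f)) := inferInstance
  have h' : IsIso (Limits.Sigma.desc
      (Cofan.mk Y fun i => pullback.fst f (Limits.Sigma.ι X i)).inj) :=
    inferInstanceAs (IsIso ((Over.forget _).map ((sigmaOverAdj X).counit.app (Over.mk f))))
  exact ⟨Cofan.isColimitOfIsIsoSigmaDesc (Cofan.mk Y fun i => pullback.fst f (Limits.Sigma.ι X i))⟩

/-- Two maps out of `Y` agree if they agree on the pieces of `Y` given by a map from `Y` to a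
coproduct. -/
theorem cover_ext {X : I → V} {Y W : V} (f : Y ⟶ ∐ X) {h k : Y ⟶ W}
    (H : ∀ (Z : V) (z : Z ⟶ Y) (i : I) (a : Z ⟶ X i), z ≫ f = a ≫ Limits.Sigma.ι X i →
      z ≫ h = z ≫ k) : h = k := by
  obtain ⟨hc⟩ := isColimit_pullback f
  exact Cofan.IsColimit.hom_ext hc _ _ fun i => H _ _ i _ pullback.condition

/-- Maps out of `Y` can be glued from maps on the pieces of `Y` given by a map from `Y` to a
coproduct. -/
theorem exists_glue {X : I → V} {Y W : V} (f : Y ⟶ ∐ X)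
    (F : ∀ i, pullback f (Limits.Sigma.ι X i) ⟶ W) :
    ∃ d : Y ⟶ W, ∀ (i : I) {Z : V} (y : Z ⟶ Y) (x : Z ⟶ X i) (h : y ≫ f = x ≫ Limits.Sigma.ι X i),
      y ≫ d = pullback.lift y x h ≫ F i := by
  obtain ⟨hc⟩ := isColimit_pullback f
  refine ⟨Cofan.IsColimit.desc hc F, fun i Z y x h => ?_⟩
  have e : pullback.fst f (Limits.Sigma.ι X i) ≫ Cofan.IsColimit.desc hc F = F i :=
    Cofan.IsColimit.fac hc F i
  rw [← e, pullback.lift_fst_assoc]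

end Extensive

/-! ### The internal category of a `V`-category -/

section Internalization

variable (V : Type u) [Category.{v} V] [CartesianMonoidalCategory V] [MonoidalClosed V]
  [HasPullbacks V] [Extensive.{w} V] (C : Type w) [EnrichedCategory V C]

attribute [local simp] pullback.lift_fst pullback.lift_snd pullback.lift_fst_assoc
  pullback.lift_snd_assoc

namespace Internalization

/-- The object of objects `∐_{A ∈ C} *`. -/
abbrev obj₀ : V := ∐ fun _ : C => 𝟙_ V

/-- The object of morphisms `∐_{A, B ∈ C} C(A, B)`. -/
abbrev obj₁ : V := ∐ fun p : C × C => (p.1 ⟶[V] p.2)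

variable {C}

/-- The coproduct inclusion of `C(A, B)` into the object of morphisms. -/
abbrev ι (A B : C) : (A ⟶[V] B) ⟶ obj₁ V C :=
  Limits.Sigma.ι (fun p : C × C => (p.1 ⟶[V] p.2)) (A, B)

/-- The coproduct inclusion of the terminal object into the object of objects. -/
abbrev ι₀ (A : C) : 𝟙_ V ⟶ obj₀ V C := Limits.Sigma.ι (fun _ : C => 𝟙_ V) A

variable (C)

/-- The source map of `Int C`, which on `C(A, B)` is the inclusion at `A`. -/
abbrev s : obj₁ V C ⟶ obj₀ V C := Limits.Sigma.desc fun p => toUnit _ ≫ ι₀ V p.1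

/-- The target map of `Int C`, which on `C(A, B)` is the inclusion at `B`. -/
abbrev t : obj₁ V C ⟶ obj₀ V C := Limits.Sigma.desc fun p => toUnit _ ≫ ι₀ V p.2

/-- The identity map of `Int C`, which at `A` is the identity of `A` in `C(A, A)`. -/
abbrev i : obj₀ V C ⟶ obj₁ V C := Limits.Sigma.desc fun A => eId V A ≫ ι V A A

variable {C}

theorem ι_s (A B : C) : ι V A B ≫ s V C = toUnit _ ≫ ι₀ V A := by simp

theorem ι_t (A B : C) : ι V A B ≫ t V C = toUnit _ ≫ ι₀ V B := by simp

theorem ι_i (A : C) : ι₀ V A ≫ i V C = eId V A ≫ ι V A A := by simp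

/-- Distinct summands of `∐_{A ∈ C} *` are disjoint. -/
theorem disjoint {Z : V} {A B : C} (hAB : A ≠ B)
    (h : toUnit Z ≫ ι₀ V A = toUnit Z ≫ ι₀ V B) : Nonempty (IsInitial Z) := by
  classical
  have : HasInitial V := inferInstance
  let Y : C → V := fun D => if D = A then Z else ⊥_ V
  have hA : Y A = Z := if_pos rfl
  have hB : Y B = ⊥_ V := if_neg hAB.symm
  have hp := isPullback_sigma (X := fun _ : C => 𝟙_ V) (fun D => toUnit (Y D)) B
  let f : Z ⟶ Y B := hp.lift (eqToHom hA.symm ≫ Limits.Sigma.ι Y A) (toUnit Z) (by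
    rw [Category.assoc, Limits.Sigma.ι_map, ← h, ← Category.assoc]
    congr 1
    exact toUnit_unique _ _)
  have := CategoryTheory.strict_initial initialIsInitial (f ≫ eqToHom hB)
  exact ⟨initialIsInitial.ofIso (asIso (f ≫ eqToHom hB)).symm⟩

/-- The inclusion of `C(A, B) × C(B, D)` into the object of composable pairs. -/
abbrev pair (A B D : C) : (A ⟶[V] B) ⊗ (B ⟶[V] D) ⟶ pullback (t V C) (s V C) :=
  pullback.lift (fst _ _ ≫ ι V A B) (snd _ _ ≫ ι V B D) (by
    rw [Category.assoc, Category.assoc, ι_t, ι_s, ← Category.assoc, ← Category.assoc]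
    congr 1
    exact toUnit_unique _ _)

theorem eq_of_ι {Z : V} {A B B' D : C} {a : Z ⟶ (A ⟶[V] B)} {b : Z ⟶ (B' ⟶[V] D)}
    (h : (a ≫ ι V A B) ≫ t V C = (b ≫ ι V B' D) ≫ s V C) : B = B' ∨ Nonempty (IsInitial Z) := by
  by_cases hB : B = B'
  · exact Or.inl hB
  · refine Or.inr (disjoint V hB ?_)
    rw [Category.assoc, ι_t, Category.assoc, ι_s, ← Category.assoc, ← Category.assoc] at h
    rwa [toUnit_unique (a ≫ toUnit _) (toUnit Z), toUnit_unique (b ≫ toUnit _) (toUnit Z)] at h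

variable (C)

/-- Two maps out of an object over the object of morphisms agree if they agree on each summand. -/
theorem ext_obj₁ {Y W : V} (f : Y ⟶ obj₁ V C) {h k : Y ⟶ W}
    (H : ∀ (Z : V) (z : Z ⟶ Y) (A B : C) (a : Z ⟶ (A ⟶[V] B)), z ≫ f = a ≫ ι V A B →
      z ≫ h = z ≫ k) : h = k :=
  cover_ext f fun Z z i a e => H Z z i.1 i.2 a e

theorem ext_pair {W : V} {h k : pullback (t V C) (s V C) ⟶ W}
    (H : ∀ A B D : C, pair V A B D ≫ h = pair V A B D ≫ k) : h = k := by
  refine ext_obj₁ V C (pullback.fst _ _) fun Z z A B a ha => ?_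
  refine ext_obj₁ V C (z ≫ pullback.snd _ _) fun Z' z' B' D b hb => ?_
  rcases eq_of_ι V (a := z' ≫ a) (b := b) (by
    rw [← hb, Category.assoc z', ← ha, Category.assoc, Category.assoc, pullback.condition,
      Category.assoc, Category.assoc]) with rfl | ⟨⟨hZ⟩⟩
  · have e : z' ≫ z = lift (z' ≫ a) b ≫ pair V A B D := by
      apply pullback.hom_ext
      · simp [ha]
      · simpa using hb
    rw [← Category.assoc, ← Category.assoc, e, Category.assoc, Category.assoc, H]
  · exact hZ.hom_ext _ _

theorem exists_desc_pair {W : V} (F : ∀ A B D : C, (A ⟶[V] B) ⊗ (B ⟶[V] D) ⟶ W) :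
    ∃ d : pullback (t V C) (s V C) ⟶ W, ∀ A B D, pair V A B D ≫ d = F A B D := by
  classical
  let S (p : C × C) := pullback.fst (pullback.fst (t V C) (s V C))
    (Limits.Sigma.ι (fun p : C × C => (p.1 ⟶[V] p.2)) p)
  let T (p : C × C) := pullback.snd (pullback.fst (t V C) (s V C))
    (Limits.Sigma.ι (fun p : C × C => (p.1 ⟶[V] p.2)) p)
  have hST (p) : S p ≫ pullback.fst _ _ = T p ≫ ι V p.1 p.2 := pullback.condition
  have h₃ (p q : C × C) (h : ¬ p.2 = q.1) : Nonempty (IsInitial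
      (pullback (S p ≫ pullback.snd (t V C) (s V C))
        (Limits.Sigma.ι (fun p : C × C => (p.1 ⟶[V] p.2)) q))) := by
    refine Or.resolve_left (eq_of_ι V (a := pullback.fst _ _ ≫ T p) (b := pullback.snd _ _) ?_) h
    rw [← pullback.condition, Category.assoc _ (T p), ← hST]
    simp only [Category.assoc]
    rw [pullback.condition (f := t V C)]
  choose d hd using fun p => exists_glue (S p ≫ pullback.snd (t V C) (s V C)) (W := W) fun q =>
      if h : p.2 = q.1 then
        lift (pullback.fst _ _ ≫ T p) (pullback.snd _ _ ≫ eqToHom (by rw [h])) ≫ F p.1 p.2 q.2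
      else IsInitial.to (h₃ p q h).some _
  obtain ⟨d', hd'⟩ := exists_glue (pullback.fst (t V C) (s V C)) d
  refine ⟨d', fun A B D => ?_⟩
  rw [hd' (A, B) (pair V A B D) (fst _ _) (by simp)]
  have hS : pullback.lift (pair V A B D) (fst _ _) (by simp) ≫ S (A, B) = pair V A B D :=
    pullback.lift_fst _ _ _
  have hT : pullback.lift (pair V A B D) (fst _ _) (by simp) ≫ T (A, B) = fst _ _ :=
    pullback.lift_snd _ _ _
  rw [hd (A, B) (B, D) _ (snd _ _) (by rw [reassoc_of% hS, pullback.lift_snd])]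
  rw [dif_pos rfl, ← Category.assoc]
  convert! Category.id_comp _
  apply CartesianMonoidalCategory.hom_ext <;> simp [hT]

/-- The object of composable pairs of `Int C` is the coproduct `∐_{A, B, D} C(A, B) × C(B, D)`. -/
theorem isColimit_pair : Nonempty (IsColimit (Cofan.mk (pullback (t V C) (s V C))
    fun p : C × C × C => pair V p.1 p.2.1 p.2.2)) := by
  choose d hd using fun W : Cofan (fun p : C × C × C => (p.1 ⟶[V] p.2.1) ⊗ (p.2.1 ⟶[V] p.2.2)) =>
    exists_desc_pair V C (fun A B D => W.inj (A, B, D))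
  exact ⟨Cofan.IsColimit.mk _ d (fun W p => hd W _ _ _) fun W m hm =>
    ext_pair V C fun A B D => (hm (A, B, D)).trans (hd W A B D).symm⟩

/-- The composition map of `Int C`, determined by its restrictions
`C(A, B) × C(B, D) ⟶ C(A, D) ⟶ (Int C)₁`. -/
def c : pullback (t V C) (s V C) ⟶ obj₁ V C :=
  Cofan.IsColimit.desc (isColimit_pair V C).some fun p => eComp V p.1 p.2.1 p.2.2 ≫ ι V p.1 p.2.2

variable {C}

theorem pair_c (A B D : C) : pair V A B D ≫ c V C = eComp V A B D ≫ ι V A D :=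
  Cofan.IsColimit.fac (isColimit_pair V C).some
    (fun p => eComp V p.1 p.2.1 p.2.2 ≫ ι V p.1 p.2.2) (A, B, D)

theorem elt_c {Z : V} {A B D : C} (w : Z ⟶ pullback (t V C) (s V C)) (a : Z ⟶ (A ⟶[V] B))
    (b : Z ⟶ (B ⟶[V] D)) (ha : w ≫ pullback.fst _ _ = a ≫ ι V A B)
    (hb : w ≫ pullback.snd _ _ = b ≫ ι V B D) :
    w ≫ c V C = (lift a b ≫ eComp V A B D) ≫ ι V A D := by
  have e : w = lift a b ≫ pair V A B D := by
    apply pullback.hom_ext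
    · rw [ha]; simp
    · rw [hb]; simp
  rw [e, Category.assoc, pair_c, Category.assoc]

theorem lift_id_comp {Z : V} {A B : C} (e : Z ⟶ 𝟙_ V) (b : Z ⟶ (A ⟶[V] B)) :
    lift (e ≫ eId V A) b ≫ eComp V A A B = b := by
  have h : lift (e ≫ eId V A) b = b ≫ (λ_ _).inv ≫ eId V A ▷ _ := by
    apply CartesianMonoidalCategory.hom_ext
    · simp only [lift_fst, Category.assoc, whiskerRight_fst, leftUnitor_inv_fst_assoc]
      rw [← Category.assoc]
      congr 1
      exact toUnit_unique _ _
    · simp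
  rw [h, Category.assoc, Category.assoc, e_id_comp, Category.comp_id]

theorem lift_comp_id {Z : V} {A B : C} (e : Z ⟶ 𝟙_ V) (b : Z ⟶ (A ⟶[V] B)) :
    lift b (e ≫ eId V B) ≫ eComp V A B B = b := by
  have h : lift b (e ≫ eId V B) = b ≫ (ρ_ _).inv ≫ _ ◁ eId V B := by
    apply CartesianMonoidalCategory.hom_ext
    · simp
    · simp only [lift_snd, Category.assoc, whiskerLeft_snd, rightUnitor_inv_snd_assoc]
      rw [← Category.assoc]
      congr 1
      exact toUnit_unique _ _
  rw [h, Category.assoc, Category.assoc, e_comp_id, Category.comp_id]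

theorem lift_assoc {Z : V} {A B D E : C} (a : Z ⟶ (A ⟶[V] B)) (b : Z ⟶ (B ⟶[V] D))
    (d : Z ⟶ (D ⟶[V] E)) :
    lift (lift a b ≫ eComp V A B D) d ≫ eComp V A D E =
      lift a (lift b d ≫ eComp V B D E) ≫ eComp V A B E := by
  have := congrArg (lift a (lift b d) ≫ ·) (e_assoc V A B D E)
  have h₁ : lift (lift a b ≫ eComp V A B D) d =
      lift a (lift b d) ≫ (α_ _ _ _).inv ≫ eComp V A B D ▷ _ := by
    apply CartesianMonoidalCategory.hom_ext <;> simp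
  have h₂ : lift a (lift b d ≫ eComp V B D E) = lift a (lift b d) ≫ _ ◁ eComp V B D E := by
    apply CartesianMonoidalCategory.hom_ext <;> simp
  rw [h₁, h₂]
  simpa only [Category.assoc] using this

end Internalization

open Internalization in
/-- The internal category `Int C` associated with a `V`-category `C`. -/
abbrev internalization : InternalCategory V where
  obj₀ := obj₀ V C
  obj₁ := obj₁ V C
  s := s V C
  t := t V C
  i := i V C
  c := c V C
  i_s := by
    apply Limits.Sigma.hom_ext
    intro A
    rw [← Category.assoc, ι_i, Category.assoc, ι_s, ← Category.assoc, Category.comp_id,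
      toUnit_unique (eId V A ≫ _) (𝟙 _), Category.id_comp]
  i_t := by
    apply Limits.Sigma.hom_ext
    intro A
    rw [← Category.assoc, ι_i, Category.assoc, ι_t, ← Category.assoc, Category.comp_id,
      toUnit_unique (eId V A ≫ _) (𝟙 _), Category.id_comp]
  c_s := by
    apply ext_pair
    intro A B D
    rw [← Category.assoc, pair_c, Category.assoc, ι_s, pullback.lift_fst_assoc, Category.assoc,
      ι_s, ← Category.assoc, ← Category.assoc]
    congr 1
    exact toUnit_unique _ _
  c_t := by
    apply ext_pair
    intro A B D
    rw [← Category.assoc, pair_c, Category.assoc, ι_t, pullback.lift_snd_assoc, Category.assoc,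
      ι_t, ← Category.assoc, ← Category.assoc]
    congr 1
    exact toUnit_unique _ _
  unit_left := by
    apply Limits.Sigma.hom_ext
    rintro ⟨A, B⟩
    change ι V A B ≫ _ = ι V A B ≫ _
    rw [← Category.assoc, elt_c V _ (toUnit _ ≫ eId V A) (𝟙 _), lift_id_comp, Category.id_comp,
      Category.comp_id]
    · rw [Category.assoc, pullback.lift_fst, ← Category.assoc, ι_s, Category.assoc, ι_i,
        Category.assoc]
    · rw [Category.assoc, pullback.lift_snd, Category.id_comp, Category.comp_id]
  unit_right := by
    apply Limits.Sigma.hom_ext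
    rintro ⟨A, B⟩
    change ι V A B ≫ _ = ι V A B ≫ _
    rw [← Category.assoc, elt_c V _ (𝟙 _) (toUnit _ ≫ eId V B), lift_comp_id, Category.id_comp,
      Category.comp_id]
    · rw [Category.assoc, pullback.lift_fst, Category.id_comp, Category.comp_id]
    · rw [Category.assoc, pullback.lift_snd, ← Category.assoc, ι_t, Category.assoc, ι_i,
        Category.assoc]
  assoc := by
    refine ext_obj₁ V C (pullback.fst _ _ ≫ pullback.fst _ _) fun Z z A B a ha => ?_
    refine ext_obj₁ V C (z ≫ pullback.fst _ _ ≫ pullback.snd _ _) fun Z' z' B' D b hb => ?_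
    refine ext_obj₁ V C (z' ≫ z ≫ pullback.snd _ _ ≫ pullback.snd _ _) fun Z'' y D' E d hd => ?_
    have hw := pullback.condition (f := pullback.snd (t V C) (s V C))
      (g := pullback.fst (t V C) (s V C))
    obtain ⟨x, hx⟩ : ∃ x, x = y ≫ z' ≫ z := ⟨_, rfl⟩
    have h₁ : (x ≫ pullback.fst _ _) ≫ pullback.fst _ _ = (y ≫ z' ≫ a) ≫ ι V A B := by
      rw [hx]
      simp only [Category.assoc, ha]
    have h₂ : (x ≫ pullback.fst _ _) ≫ pullback.snd _ _ = (y ≫ b) ≫ ι V B' D := by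
      rw [hx]
      simp only [Category.assoc, ← hb]
    have h₃ : (x ≫ pullback.snd _ _) ≫ pullback.fst _ _ = (y ≫ b) ≫ ι V B' D := by
      rw [← h₂, Category.assoc, Category.assoc, hw]
    have h₄ : (x ≫ pullback.snd _ _) ≫ pullback.snd _ _ = d ≫ ι V D' E := by
      rw [hx, ← hd]
      simp only [Category.assoc]
    rw [← Category.assoc z', ← Category.assoc y (z' ≫ z), ← Category.assoc z',
      ← Category.assoc y (z' ≫ z), ← hx]
    rcases eq_of_ι V (a := y ≫ z' ≫ a) (b := y ≫ b) (by
      rw [← h₁, ← h₂, Category.assoc _ _ (t V C), Category.assoc _ _ (s V C),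
        pullback.condition]) with rfl | ⟨⟨hZ⟩⟩
    swap
    · exact hZ.hom_ext _ _
    rcases eq_of_ι V (a := y ≫ b) (b := d) (by
      rw [← h₃, ← h₄, Category.assoc _ _ (t V C), Category.assoc _ _ (s V C),
        pullback.condition]) with rfl | ⟨⟨hZ⟩⟩
    swap
    · exact hZ.hom_ext _ _
    have h₅ := elt_c V _ _ _ h₁ h₂
    have h₆ := elt_c V _ _ _ h₃ h₄
    rw [← Category.assoc x, ← Category.assoc x,
      elt_c V _ (lift (y ≫ z' ≫ a) (y ≫ b) ≫ eComp V A B D) d,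
      elt_c V _ (y ≫ z' ≫ a) (lift (y ≫ b) d ≫ eComp V B D E), lift_assoc]
    · rw [Category.assoc, pullback.lift_fst, ← Category.assoc, h₁]
    · rw [Category.assoc, pullback.lift_snd, ← Category.assoc, h₆]
    · rw [Category.assoc, pullback.lift_fst, ← Category.assoc, h₅]
    · rw [Category.assoc, pullback.lift_snd, ← Category.assoc, h₄]

end Internalization

/-! ### The underlying `V`-category -/

section Underlying

variable {V : Type u} [Category.{v} V] [CartesianMonoidalCategory V] [HasPullbacks V]

attribute [local simp] pullback.lift_fst pullback.lift_snd pullback.lift_fst_assoc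
  pullback.lift_snd_assoc

/-- The set of objects of the `V`-category underlying an internal category `A`: the maps
`* ⟶ A₀`. -/
structure Und (A : InternalCategory V) where
  /-- the underlying map -/
  pt : 𝟙_ V ⟶ A.obj₀

namespace Und

variable {A : InternalCategory V}

/-- The hom object from `a` to `b`: the pullback of `(s, t) : A₁ ⟶ A₀ × A₀` along
`(a, b) : * ⟶ A₀ × A₀`. -/
abbrev hom (a b : Und A) : V := pullback (lift A.s A.t) (lift a.pt b.pt)

/-- The projection of a hom object to `A₁`. -/
abbrev ι (a b : Und A) : hom a b ⟶ A.obj₁ := pullback.fst _ _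

theorem ι_s (a b : Und A) : ι a b ≫ A.s = toUnit _ ≫ a.pt := by
  have h := congrArg (· ≫ fst _ _) (pullback.condition (f := lift A.s A.t) (g := lift a.pt b.pt))
  simp only [Category.assoc, lift_fst] at h
  rw [h]
  congr 1
  exact toUnit_unique _ _

theorem ι_t (a b : Und A) : ι a b ≫ A.t = toUnit _ ≫ b.pt := by
  have h := congrArg (· ≫ snd _ _) (pullback.condition (f := lift A.s A.t) (g := lift a.pt b.pt))
  simp only [Category.assoc, lift_snd] at h
  rw [h]
  congr 1
  exact toUnit_unique _ _

/-- The generalized element of a hom object given by a generalized morphism of `A`. -/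
abbrev mk' {a b : Und A} {Y : V} (f : Y ⟶ A.obj₁) (hs : f ≫ A.s = toUnit Y ≫ a.pt)
    (ht : f ≫ A.t = toUnit Y ≫ b.pt) : Y ⟶ hom a b :=
  pullback.lift f (toUnit Y) (by
    apply CartesianMonoidalCategory.hom_ext <;> simp [hs, ht])

theorem hom_ext {a b : Und A} {Y : V} {f g : Y ⟶ hom a b} (h : f ≫ ι a b = g ≫ ι a b) : f = g :=
  pullback.hom_ext h (toUnit_unique _ _)

/-- The identity of `a`, induced by the identity map of `A`. -/
abbrev id (a : Und A) : 𝟙_ V ⟶ hom a a :=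
  mk' (a.pt ≫ A.i) (by rw [Category.assoc, A.i_s, toUnit_unique (toUnit _) (𝟙 (𝟙_ V))]; simp)
    (by rw [Category.assoc, A.i_t, toUnit_unique (toUnit _) (𝟙 (𝟙_ V))]; simp)

theorem comp_aux {a b d : Und A} {Y : V} (f : Y ⟶ hom a b) (g : Y ⟶ hom b d) :
    (f ≫ ι a b) ≫ A.t = (g ≫ ι b d) ≫ A.s := by
  rw [Category.assoc, Category.assoc, ι_t, ι_s, ← Category.assoc, ← Category.assoc]
  congr 1
  exact toUnit_unique _ _

/-- Composition of morphisms, induced by the composition map of `A`. -/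
abbrev comp (a b d : Und A) : hom a b ⊗ hom b d ⟶ hom a d :=
  mk' (A.comp (fst _ _ ≫ ι a b) (snd _ _ ≫ ι b d) (comp_aux _ _))
    (by
      rw [A.comp_s, Category.assoc, ι_s, ← Category.assoc]
      congr 1
      exact toUnit_unique _ _)
    (by
      rw [A.comp_t, Category.assoc, ι_t, ← Category.assoc]
      congr 1
      exact toUnit_unique _ _)

theorem precomp {a b d : Und A} {Y : V} (z : Y ⟶ hom a b ⊗ hom b d) :
    z ≫ comp a b d ≫ ι a d =
      A.comp ((z ≫ fst _ _) ≫ ι a b) ((z ≫ snd _ _) ≫ ι b d) (comp_aux _ _) := by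
  rw [pullback.lift_fst, A.precomp]
  exact A.comp_congr _ (Category.assoc _ _ _).symm (Category.assoc _ _ _).symm

end Und

/-- The underlying `V`-category `Und A` of an internal category `A`. -/
instance (A : InternalCategory V) : EnrichedCategory V (Und A) where
  Hom := Und.hom
  id := Und.id
  comp := Und.comp
  id_comp a b := by
    apply Und.hom_ext
    rw [Category.id_comp, Category.assoc, Category.assoc, ← Category.assoc (λ_ _).inv, Und.precomp]
    refine (A.comp_congr _ (f' := (toUnit _ ≫ a.pt) ≫ A.i) (g' := Und.ι a b) ?_ ?_).trans
      (A.id_comp _ _ ?_)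
    · rw [Category.assoc _ a.pt]
      simp only [Category.assoc, whiskerRight_fst, pullback.lift_fst, leftUnitor_inv_fst_assoc]
    · simp
    · rw [Category.assoc, A.i_t, Und.ι_s, Category.comp_id]
  comp_id a b := by
    apply Und.hom_ext
    rw [Category.id_comp, Category.assoc, Category.assoc, ← Category.assoc (ρ_ _).inv, Und.precomp]
    refine (A.comp_congr _ (f' := Und.ι a b) (g' := (toUnit _ ≫ b.pt) ≫ A.i) ?_ ?_).trans
      (A.comp_id _ _ ?_)
    · simp
    · rw [Category.assoc _ b.pt]
      simp only [Category.assoc, whiskerLeft_snd, pullback.lift_fst, rightUnitor_inv_snd_assoc]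
    · rw [Category.assoc, A.i_s, Und.ι_t, Category.comp_id]
  assoc a b d e := by
    apply Und.hom_ext
    rw [Category.assoc, Category.assoc, ← Category.assoc (α_ _ _ _).inv, Und.precomp,
      Category.assoc (Und.hom a b ◁ Und.comp b d e), Und.precomp]
    have h₁ : (((α_ (Und.hom a b) (Und.hom b d) (Und.hom d e)).inv ≫ Und.comp a b d ▷ _) ≫
        fst _ _) ≫ Und.ι a d = A.comp (fst _ _ ≫ Und.ι a b) ((snd _ _ ≫ fst _ _) ≫ Und.ι b d)
          (Und.comp_aux _ _) := by
      rw [Category.assoc (α_ _ _ _).inv, whiskerRight_fst, ← Category.assoc, Category.assoc,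
        Und.precomp]
      exact A.comp_congr _ (by simp) (by simp)
    have h₂ : ((Und.hom a b ◁ Und.comp b d e) ≫ snd _ _) ≫ Und.ι b e =
        A.comp ((snd _ _ ≫ fst _ _) ≫ Und.ι b d) ((snd _ _ ≫ snd _ _) ≫ Und.ι d e)
          (Und.comp_aux _ _) := by
      rw [whiskerLeft_snd, Category.assoc, Und.precomp]
    refine (A.comp_congr _ h₁ (g' := (snd _ _ ≫ snd _ _) ≫ Und.ι d e) (by simp)).trans
      (Eq.trans (A.comp_assoc _ _ _ _ (Und.comp_aux (snd _ _ ≫ fst _ _) (snd _ _ ≫ snd _ _)))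
        (A.comp_congr ?_ (f := fst _ _ ≫ Und.ι a b) (by simp) h₂.symm))
    rw [A.comp_s]
    exact Und.comp_aux (fst _ _) (snd _ _ ≫ fst _ _)

end Underlying

section Terminal

/-- An object `T` of a `V`-category `C` is `V`-terminal if `C(A, T) ⟶ *` is an isomorphism for
every object `A`. -/
def IsVTerminal (V : Type u) [Category.{v} V] [CartesianMonoidalCategory V] {C : Type*}
    [EnrichedCategory V C] (T : C) : Prop :=
  ∀ A : C, IsIso (toUnit (A ⟶[V] T))

/-- A family `G` of objects of `V` is conservative if a map `f` of `V` is an isomorphism exactly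
when postcomposition with `f` is a bijection `V(X, Y) ⟶ V(X, Z)` for all `X` in `G`. -/
def IsConservativeFamily {V : Type u} [Category.{v} V] (G : ObjectProperty V) : Prop :=
  ∀ ⦃Y Z : V⦄ (f : Y ⟶ Z), IsIso f ↔ ∀ X : V, G X → Function.Bijective fun g : X ⟶ Y => g ≫ f

end Terminal

/-! ### Internal tensors -/

section Tensors

variable {V : Type u} [Category.{v} V] [CartesianMonoidalCategory V] [MonoidalClosed V]
  [HasPullbacks V] [Extensive.{w} V] {C : Type w} [EnrichedCategory V C]
  {A : InternalCategory V} (P : A ⟶ internalization V C)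

/-- The fibre of `P : A ⟶ Int C` at an object `c` of `C`: the pullback of `P₀` along the coproduct
inclusion `* ⟶ ∐_{A ∈ C} *` at `c`. -/
abbrev fiber (c : C) : V := pullback P.f₀ (Internalization.ι₀ V c)

/-- The map from the fibre of `P` at `c` to `A₀`. -/
abbrev fiberι (c : C) : fiber P c ⟶ A.obj₀ := pullback.fst _ _

/-- `A` has all `C`-internal tensors by `X`: for every object `c` of `C` and every map
`G : X ⟶ P⁻¹ c`, the internal functor `cst X ⟶ A` corresponding to `X ⟶ P⁻¹ c ⟶ A₀` has an
internal colimit. -/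
def HasInternalTensors (X : V) : Prop :=
  ∀ (c : C) (G : X ⟶ fiber P c), ∃ e : (InternalCategory.cocones
    (InternalCategory.cstDesc (G ≫ fiberι P c))).Element, InternalCategory.IsInternalColimit _ e

end Tensors

end InternalTensors

end

/-!
Write `τ : * ⟶ A₀` for the point underlying `(c, x)`. In terms of generalized objects, `τ` is
internal terminal exactly when every `y : Y ⟶ A₀` admits a unique generalized morphism
`f : Y ⟶ A₁` from `y` to the constant object at `τ` (`isInternalTerminal_iff`), and `τ` is
`V`-terminal in `Und A` exactly when this holds for the constant `y`, those that factor through a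
point `* ⟶ A₀` (`isVTerminal_iff`). This makes one implication immediate.

For the other implication, the general `y` is reduced to constant ones in three steps. Since `V` is
extensive, `A₀` is the coproduct of the fibres of `P`, so it suffices to treat those `y` that factor
through a fibre (`existsUnique_of_fiber`). The assertion for all maps into the fibre at `d` says that
a projection from a pullback to that fibre is invertible (`isIso_snd_iff`); as `𝒢` is conservative,
this may be tested on maps `G : X ⟶ P⁻¹ d` with `X` in `𝒢`. Finally, such a `G` has an internal
colimit with apex `k : * ⟶ A₀`, and morphisms from `G` to the constant object at `τ` are the
cocones under `G` with apex `τ`, which correspond to morphisms from `k` to `τ`. The latter are the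
points of the hom object of `Und A` from `k` to `τ`, so there is exactly one if `τ` is `V`-terminal
(`IsInternalColimit.existsUnique_leg`).
-/

namespace InternalTensors

/-! ### Pullback projections and unique lifts -/

section PullbackProjections

variable {V : Type u} [Category.{v} V]

/-- Bijectivity of a pullback projection on maps out of a single object `X`; for all `X` at once
this is invertibility, see `isIso_snd_iff`. -/
theorem bijective_comp_snd_iff {W X₁ X₂ Z : V} {p : W ⟶ X₁} {q : W ⟶ X₂} {f : X₁ ⟶ Z} {g : X₂ ⟶ Z}
    (h : IsPullback p q f g) (X : V) :
    (Function.Bijective fun w : X ⟶ W => w ≫ q) ↔ ∀ y : X ⟶ X₂, ∃! z : X ⟶ X₁, z ≫ f = y ≫ g := by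
  constructor
  · intro hb y
    obtain ⟨w, hw⟩ := hb.2 y
    dsimp only at hw
    refine ⟨w ≫ p, by simp only [Category.assoc, h.w, ← hw], fun z hz => ?_⟩
    have : h.lift z y hz = w := hb.1 (by simp [hw])
    rw [← this, h.lift_fst]
  · refine fun H => ⟨fun a b hab => ?_, fun y => ?_⟩
    · dsimp only at hab
      refine h.hom_ext ((H (b ≫ q)).unique ?_ ?_) hab
      · rw [← hab, Category.assoc, Category.assoc, h.w]
      · rw [Category.assoc, Category.assoc, h.w]
    · obtain ⟨z, hz, -⟩ := H y
      exact ⟨h.lift z y hz, h.lift_snd _ _ _⟩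

theorem isIso_snd_iff {W X₁ X₂ Z : V} {p : W ⟶ X₁} {q : W ⟶ X₂} {f : X₁ ⟶ Z} {g : X₂ ⟶ Z}
    (h : IsPullback p q f g) :
    IsIso q ↔ ∀ (Y : V) (y : Y ⟶ X₂), ∃! z : Y ⟶ X₁, z ≫ f = y ≫ g := by
  rw [isIso_iff_yoneda_map_bijective]
  exact forall_congr' (bijective_comp_snd_iff h)

variable [CartesianMonoidalCategory V]

theorem comp_lift_eq_iff {Y X₁ X₂ Z W : V} (a : Y ⟶ X₁) (f : X₁ ⟶ Z) (g : X₁ ⟶ W) (b : Y ⟶ X₂)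
    (f' : X₂ ⟶ Z) (g' : X₂ ⟶ W) :
    a ≫ lift f g = b ≫ lift f' g' ↔ a ≫ f = b ≫ f' ∧ a ≫ g = b ≫ g' := by
  constructor
  · intro h
    constructor
    · simpa using congrArg (· ≫ fst _ _) h
    · simpa using congrArg (· ≫ snd _ _) h
  · rintro ⟨h, h'⟩
    apply CartesianMonoidalCategory.hom_ext <;> simp [h, h']

end PullbackProjections

/-! ### Internal terminal and initial objects in terms of generalized morphisms -/

section GeneralizedMorphisms

variable {V : Type u} [Category.{v} V] [HasPullbacks V]

theorem InternalFunctor.isIso_of_isIso {A B : InternalCategory V} (F : A ⟶ B) [IsIso F.f₀]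
    [IsIso F.f₁] : IsIso F := by
  let K : B ⟶ A := InternalFunctor.ofElements (inv F.f₀) (inv F.f₁)
    (by rw [IsIso.inv_comp_eq, ← Category.assoc, F.map_s, Category.assoc, IsIso.hom_inv_id,
      Category.comp_id])
    (by rw [IsIso.inv_comp_eq, ← Category.assoc, F.map_t, Category.assoc, IsIso.hom_inv_id,
      Category.comp_id])
    (by rw [IsIso.eq_inv_comp, ← Category.assoc, ← F.map_i, Category.assoc, IsIso.hom_inv_id,
      Category.comp_id])
    (fun f g h h' => by
      rw [← cancel_mono F.f₁, F.map_comp]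
      simp only [Category.assoc, IsIso.inv_hom_id, Category.comp_id])
  exact ⟨K, InternalFunctor.ext (IsIso.hom_inv_id F.f₀) (IsIso.hom_inv_id F.f₁),
    InternalFunctor.ext (IsIso.inv_hom_id F.f₀) (IsIso.inv_hom_id F.f₁)⟩

theorem InternalFunctor.isIso_f₀ {A B : InternalCategory V} (F : A ⟶ B) [IsIso F] :
    IsIso F.f₀ :=
  ⟨(inv F).f₀, congrArg InternalFunctor.f₀ (IsIso.hom_inv_id F),
    congrArg InternalFunctor.f₀ (IsIso.inv_hom_id F)⟩

variable [CartesianMonoidalCategory V]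

namespace InternalCategory

variable (A : InternalCategory V)

theorem Element.f₁_s (T : A.Element) : T.f₁ ≫ A.s = T.f₀ := T.map_s.trans (Category.id_comp _)

theorem Element.f₁_t (T : A.Element) : T.f₁ ≫ A.t = T.f₀ := T.map_t.trans (Category.id_comp _)

/-- A generalized element characterization of internal terminal objects. On objects it is the
universal property of the pullback defining the slice; on morphisms the uniqueness of morphisms
into `T` forces the squares in question to commute. -/
theorem isInternalTerminal_iff (T : A.Element) :
    A.IsInternalTerminal T ↔ ∀ (Y : V) (y : Y ⟶ A.obj₀),
      ∃! f : Y ⟶ A.obj₁, f ≫ A.s = y ∧ f ≫ A.t = toUnit Y ≫ T.f₀ := by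
  have hp₀ := (IsPullback.of_hasPullback (prodLift (𝟙 A) (toTerminal A ≫ T)).f₀
    (endpoints A).f₀).flip
  have hp₁ := (IsPullback.of_hasPullback (prodLift (𝟙 A) (toTerminal A ≫ T)).f₁
    (endpoints A).f₁).flip
  have e₀ : IsIso (sliceProj A T).f₀ ↔ ∀ (Y : V) (y : Y ⟶ A.obj₀),
      ∃! f : Y ⟶ A.obj₁, f ≫ A.s = y ∧ f ≫ A.t = toUnit Y ≫ T.f₀ := by
    refine (isIso_snd_iff hp₀).trans (forall_congr' fun Y => forall_congr' fun y =>
      existsUnique_congr fun f => (comp_lift_eq_iff _ _ _ _ _ _).trans (and_congr ?_ ?_))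
    · exact iff_of_eq (congrArg _ (Category.comp_id _))
    · refine iff_of_eq (congrArg _ ((Category.assoc _ _ _).symm.trans ?_))
      congr 1
      exact toUnit_unique _ _
  constructor
  · intro h
    have : IsIso (sliceProj A T) := h
    exact e₀.1 (InternalFunctor.isIso_f₀ _)
  · intro H
    have : IsIso (sliceProj A T).f₀ := e₀.2 H
    have : IsIso (sliceProj A T).f₁ := by
      refine (isIso_snd_iff hp₁).2 fun Y p => ?_
      obtain ⟨u, ⟨hus, hut⟩, hu⟩ := H Y (p ≫ A.s)
      obtain ⟨w, ⟨hws, hwt⟩, hw⟩ := H Y (p ≫ A.t)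
      have key (z : Y ⟶ A.sq) : z ≫ (endpoints A).f₁ = p ≫ (prodLift (𝟙 A) (toTerminal A ≫ T)).f₁ ↔
          z ≫ A.sqP = p ∧ z ≫ A.sqQ = toUnit Y ≫ T.f₁ := by
        refine (comp_lift_eq_iff _ _ _ _ _ _).trans (and_congr ?_ ?_)
        · exact iff_of_eq (congrArg _ (Category.comp_id _))
        · refine iff_of_eq (congrArg _ ((Category.assoc _ _ _).symm.trans ?_))
          congr 1
          exact toUnit_unique _ _
      have h₁ : u ≫ A.t = (toUnit Y ≫ T.f₁) ≫ A.s := by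
        rw [hut, Category.assoc, Element.f₁_s]
      refine ⟨A.sqLift u (toUnit Y ≫ T.f₁) p w h₁ hws.symm ?_, ?_, fun z hz => ?_⟩
      · refine (H Y (p ≫ A.s)).unique ⟨?_, ?_⟩ ⟨?_, ?_⟩
        · rw [comp_s, hus]
        · rw [comp_t, Category.assoc, Element.f₁_t]
        · rw [comp_s]
        · rw [comp_t, hwt]
      · exact (key _).2 ⟨A.sqLift_sqP _ _ _ _ _ _ _, A.sqLift_sqQ _ _ _ _ _ _ _⟩
      · obtain ⟨hP, hQ⟩ := (key z).1 hz
        apply sq_ext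
        · rw [sqLift_sqU]
          exact hu _ ⟨by rw [A.sq_s, hP],
            by rw [A.sq_uq, hQ, Category.assoc, Element.f₁_s]⟩
        · rw [sqLift_sqQ, hQ]
        · rw [sqLift_sqP, hP]
        · rw [sqLift_sqV]
          exact hw _ ⟨by rw [← A.sq_pv, hP],
            by rw [← A.sq_t, hQ, Category.assoc, Element.f₁_t]⟩
    exact InternalFunctor.isIso_of_isIso _

theorem IsInternalInitial.exists_hom {A : InternalCategory V} {I : A.Element}
    (h : A.IsInternalInitial I) {Y : V} (y : Y ⟶ A.obj₀) :
    ∃ f : Y ⟶ A.obj₁, f ≫ A.s = toUnit Y ≫ I.f₀ ∧ f ≫ A.t = y := by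
  have : IsIso (cosliceProj A I) := h
  obtain ⟨f, hf, -⟩ := (isIso_snd_iff (IsPullback.of_hasPullback
    (prodLift (toTerminal A ≫ I) (𝟙 A)).f₀ (endpoints A).f₀).flip).1
    (InternalFunctor.isIso_f₀ (cosliceProj A I)) Y y
  obtain ⟨h₁, h₂⟩ := (comp_lift_eq_iff _ _ _ _ _ _).1 hf
  refine ⟨f, h₁.trans ((Category.assoc _ _ _).symm.trans ?_), h₂.trans (Category.comp_id _)⟩
  congr 1
  exact toUnit_unique _ _

end InternalCategory

theorem isVTerminal_iff {A : InternalCategory V} (T : Und A) :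
    IsVTerminal V T ↔ ∀ (a : 𝟙_ V ⟶ A.obj₀) (Y : V),
      ∃! f : Y ⟶ A.obj₁, f ≫ A.s = toUnit Y ≫ a ∧ f ≫ A.t = toUnit Y ≫ T.pt := by
  have key (a : Und A) : IsIso (toUnit (a ⟶[V] T)) ↔ ∀ Y : V,
      ∃! f : Y ⟶ A.obj₁, f ≫ A.s = toUnit Y ≫ a.pt ∧ f ≫ A.t = toUnit Y ≫ T.pt := by
    have hp := IsPullback.of_hasPullback (lift A.s A.t) (lift a.pt T.pt)
    have e : toUnit (a ⟶[V] T) = pullback.snd (lift A.s A.t) (lift a.pt T.pt) :=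
      toUnit_unique _ _
    rw [e]
    refine (isIso_snd_iff hp).trans (forall_congr' fun Y => ⟨fun H => ?_, fun H y => ?_⟩)
    · exact (existsUnique_congr fun f => comp_lift_eq_iff _ _ _ _ _ _).1
        (H (toUnit Y))
    · rw [toUnit_unique y (toUnit Y)]
      exact (existsUnique_congr fun f => comp_lift_eq_iff _ _ _ _ _ _).2 H
  exact ⟨fun h a => (key ⟨a⟩).1 (h ⟨a⟩), fun h a => (key a).2 (h a.pt)⟩

end GeneralizedMorphisms

/-! ### Cocones with a given apex -/

section Cocones

open MonoidalClosed

variable {V : Type u} [Category.{v} V] [CartesianMonoidalCategory V] [MonoidalClosed V]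

/-- The point of `[X, Y]` corresponding to a map `X ⟶ Y`. -/
noncomputable abbrev pointOfHom {X Y : V} (f : X ⟶ Y) : 𝟙_ V ⟶ (ihom X).obj Y :=
  curry (fst X (𝟙_ V) ≫ f)

theorem pointOfHom_bijective (X Y : V) :
    Function.Bijective (pointOfHom : (X ⟶ Y) → (𝟙_ V ⟶ (ihom X).obj Y)) := by
  refine ⟨fun f f' h => ?_, fun w => ⟨(ρ_ X).inv ≫ uncurry w, ?_⟩⟩
  · have h' := curry_injective h
    rwa [← rightUnitor_hom, Iso.cancel_iso_hom_left] at h'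
  · rw [pointOfHom, ← rightUnitor_hom, Iso.hom_inv_id_assoc, curry_uncurry]

theorem pointOfHom_comp {X Y Z : V} (f : X ⟶ Y) (g : Y ⟶ Z) :
    pointOfHom f ≫ (ihom X).map g = pointOfHom (f ≫ g) := by
  rw [pointOfHom, pointOfHom, ← curry_natural_right, Category.assoc]

variable [HasPullbacks V]

namespace InternalCategory

variable {X : V} {A : InternalCategory V} {G : cst X ⟶ A}

/-- The apex of a cocone. -/
noncomputable abbrev coconeApex (e : (cocones G).Element) : 𝟙_ V ⟶ A.obj₀ :=
  e.f₀ ≫ pullback.fst _ _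

/-- The legs of a cocone, as a point of `[X, A₁]`. -/
noncomputable abbrev coconeLegs (e : (cocones G).Element) : 𝟙_ V ⟶ (homCst X A).obj₁ :=
  e.f₀ ≫ pullback.snd _ _

theorem coconeLegs_s (e : (cocones G).Element) :
    coconeLegs e ≫ (homCst X A).s = pointOfHom G.f₀ := by
  have h := (comp_lift_eq_iff (e.f₀ ≫ pullback.snd _ _) _ _ (e.f₀ ≫ pullback.fst _ _) _ _).1 (by
    rw [Category.assoc, Category.assoc]
    exact congrArg (e.f₀ ≫ ·) pullback.condition.symm)
  refine h.1.trans ((Category.assoc _ _ _).symm.trans ?_)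
  rw [toUnit_unique (_ ≫ (toTerminal A).f₀) (𝟙 (𝟙_ V))]
  exact Category.id_comp _

theorem coconeLegs_t (e : (cocones G).Element) :
    coconeLegs e ≫ (homCst X A).t = coconeApex e ≫ (diag X A).f₀ :=
  ((comp_lift_eq_iff (e.f₀ ≫ pullback.snd _ _) _ _ (e.f₀ ≫ pullback.fst _ _) _ _).1 (by
    rw [Category.assoc, Category.assoc]
    exact congrArg (e.f₀ ≫ ·) pullback.condition.symm)).2

theorem comp_diag {X : V} (a : 𝟙_ V ⟶ A.obj₀) :
    a ≫ (diag X A).f₀ = pointOfHom (toUnit X ≫ a) := by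
  change a ≫ curry (snd X A.obj₀) = _
  rw [← curry_natural_left, whiskerLeft_snd, pointOfHom, ← Category.assoc]
  congr 2
  exact toUnit_unique _ _

theorem coconeLegs_t_eq_diag_s (e : (cocones G).Element) {m : 𝟙_ V ⟶ A.obj₁}
    (hm : m ≫ A.s = coconeApex e) :
    coconeLegs e ≫ (homCst X A).t = (m ≫ (diag X A).f₁) ≫ (homCst X A).s := by
  rw [coconeLegs_t, ← hm, Category.assoc, Category.assoc, (diag X A).map_s]

/-- Every cocone with apex `τ` is obtained from an internal colimit cocone by composing its legs
with a morphism from its apex to `τ`. -/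
theorem IsInternalColimit.exists_factorization {e : (cocones G).Element}
    (he : IsInternalColimit G e) {τ : 𝟙_ V ⟶ A.obj₀} {f : X ⟶ A.obj₁} (hs : f ≫ A.s = G.f₀)
    (ht : f ≫ A.t = toUnit X ≫ τ) :
    ∃ (m : 𝟙_ V ⟶ A.obj₁) (hm : m ≫ A.s = coconeApex e), m ≫ A.t = τ ∧
      (homCst X A).comp (coconeLegs e) (m ≫ (diag X A).f₁) (coconeLegs_t_eq_diag_s e hm) =
        pointOfHom f := by
  -- the cocone with apex `τ` and legs `f`
  obtain ⟨z, hz₀, hz₁⟩ : ∃ z : 𝟙_ V ⟶ (cocones G).obj₀,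
      z ≫ pullback.fst _ _ = τ ∧ z ≫ pullback.snd _ _ = pointOfHom f := by
    refine ⟨pullback.lift τ (pointOfHom f) ?_,
      pullback.lift_fst _ _ _, pullback.lift_snd _ _ _⟩
    refine ((comp_lift_eq_iff _ _ _ _ _ _).2 ⟨?_, ?_⟩).symm
    · refine (pointOfHom_comp f A.s).trans ?_
      rw [hs]
      refine Eq.trans ?_ (Category.assoc τ _ _)
      rw [toUnit_unique (τ ≫ (toTerminal A).f₀) (𝟙 (𝟙_ V))]
      exact (Category.id_comp _).symm
    · refine (pointOfHom_comp f A.t).trans ?_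
      rw [ht, comp_diag]
  obtain ⟨d, hds, hdt⟩ := IsInternalInitial.exists_hom he z
  rw [toUnit_unique (toUnit (𝟙_ V)) (𝟙 _), Category.id_comp] at hds
  have hds₀ : (d ≫ pullback.fst _ _) ≫ A.s = coconeApex e := by
    rw [coconeApex, ← hds, Category.assoc, Category.assoc]
    exact congrArg (d ≫ ·) (pullback.lift_fst _ _ _).symm
  have hds₁ : (d ≫ pullback.snd _ _) ≫ (homCst X A).sqU = coconeLegs e := by
    rw [coconeLegs, ← hds, Category.assoc, Category.assoc]
    exact congrArg (d ≫ ·) (pullback.lift_snd _ _ _).symm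
  have hdt₀ : (d ≫ pullback.fst _ _) ≫ A.t = τ := by
    refine Eq.trans ?_ hz₀
    rw [← hdt, Category.assoc, Category.assoc]
    exact congrArg (d ≫ ·) (pullback.lift_fst _ _ _).symm
  have hdt₁ : (d ≫ pullback.snd _ _) ≫ (homCst X A).sqV = pointOfHom f := by
    refine Eq.trans ?_ hz₁
    rw [← hdt, Category.assoc, Category.assoc]
    exact congrArg (d ≫ ·) (pullback.lift_snd _ _ _).symm
  obtain ⟨hP, hQ⟩ := (comp_lift_eq_iff (d ≫ pullback.snd _ _) _ _ (d ≫ pullback.fst _ _) _ _).1 (by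
    rw [Category.assoc, Category.assoc]
    exact congrArg (d ≫ ·) pullback.condition.symm)
  refine ⟨d ≫ pullback.fst _ _, hds₀, hdt₀, ?_⟩
  have hcomm := (homCst X A).sq_comm (d ≫ pullback.snd _ _)
  -- the side of the square over the point `G` is an identity, so that the square is a triangle
  have hP' : (d ≫ pullback.snd _ _) ≫ (homCst X A).sqP =
      pointOfHom G.f₀ ≫ (homCst X A).i := by
    refine hP.trans ((Category.assoc _ _ _).symm.trans ?_)
    rw [toUnit_unique (_ ≫ (toTerminal A).f₁) (𝟙 (𝟙_ V))]
    exact Category.id_comp _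
  refine Eq.trans ((homCst X A).comp_congr _ hds₁.symm hQ.symm) (hcomm.trans ?_)
  exact ((homCst X A).comp_congr _ hP' hdt₁).trans ((homCst X A).id_comp _ _ _)

/-- If an internal functor `G : cst X ⟶ A` has an internal colimit whose apex has exactly one
morphism to `τ`, then there is exactly one cocone under `G` with apex `τ`. -/
theorem IsInternalColimit.existsUnique_leg {e : (cocones G).Element}
    (he : IsInternalColimit G e) {τ : 𝟙_ V ⟶ A.obj₀}
    (h : ∃! m : 𝟙_ V ⟶ A.obj₁, m ≫ A.s = coconeApex e ∧ m ≫ A.t = τ) :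
    ∃! f : X ⟶ A.obj₁, f ≫ A.s = G.f₀ ∧ f ≫ A.t = toUnit X ≫ τ := by
  obtain ⟨m, ⟨hms, hmt⟩, hm⟩ := h
  obtain ⟨f, hf⟩ := (pointOfHom_bijective X A.obj₁).2
    ((homCst X A).comp (coconeLegs e) (m ≫ (diag X A).f₁) (coconeLegs_t_eq_diag_s e hms))
  refine ⟨f, ⟨?_, ?_⟩, fun f' ⟨hs', ht'⟩ => ?_⟩
  · apply (pointOfHom_bijective X A.obj₀).1
    rw [← pointOfHom_comp, hf]
    exact ((homCst X A).comp_s _ _ _).trans (coconeLegs_s e)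
  · apply (pointOfHom_bijective X A.obj₀).1
    rw [← pointOfHom_comp, hf, ← comp_diag]
    refine ((homCst X A).comp_t _ _ _).trans ?_
    rw [Category.assoc, (diag X A).map_t, ← Category.assoc, hmt]
  · obtain ⟨m', hms', hmt', hm'⟩ := he.exists_factorization hs' ht'
    obtain rfl : m' = m := hm _ ⟨hms', hmt'⟩
    exact (pointOfHom_bijective X A.obj₁).1 (hm'.symm.trans hf.symm)

end InternalCategory

end Cocones

/-! ### Descent to the fibres -/

section Fibers

variable {V : Type u} [Category.{v} V] [CartesianMonoidalCategory V] [MonoidalClosed V]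
  [HasPullbacks V] [Extensive.{w} V] {C : Type w} [EnrichedCategory V C]
  {A : InternalCategory V} (P : A ⟶ internalization V C)

/-- By extensivity, unique existence of morphisms into the constant object at `τ` may be checked on
generalized objects of the fibres of `P`: over an arbitrary `Y`, morphisms are glued from the
pieces of `Y` lying over the objects of `C`. -/
theorem existsUnique_of_fiber {τ : 𝟙_ V ⟶ A.obj₀}
    (H : ∀ (d : C) (Y : V) (y : Y ⟶ fiber P d),
      ∃! f : Y ⟶ A.obj₁, f ≫ A.s = y ≫ fiberι P d ∧ f ≫ A.t = toUnit Y ≫ τ)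
    (Y : V) (y : Y ⟶ A.obj₀) :
    ∃! f : Y ⟶ A.obj₁, f ≫ A.s = y ∧ f ≫ A.t = toUnit Y ≫ τ := by
  have H' (d : C) (Z : V) (z : Z ⟶ A.obj₀) (a : Z ⟶ 𝟙_ V)
      (h : z ≫ P.f₀ = a ≫ Internalization.ι₀ V d) :
      ∃! f : Z ⟶ A.obj₁, f ≫ A.s = z ∧ f ≫ A.t = toUnit Z ≫ τ := by
    have := H d Z (pullback.lift z a h)
    rwa [pullback.lift_fst] at this
  choose F hF hF' using fun d => H' d (pullback (y ≫ P.f₀) (Internalization.ι₀ V d))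
    (pullback.fst _ _ ≫ y) (pullback.snd _ _) (by rw [Category.assoc, pullback.condition])
  obtain ⟨f, hf⟩ := exists_glue (y ≫ P.f₀) F
  refine ⟨f, ⟨?_, ?_⟩, fun g ⟨hgs, hgt⟩ => ?_⟩
  · refine cover_ext (y ≫ P.f₀) fun Z z d a h => ?_
    rw [← Category.assoc, hf d z a h, Category.assoc, (hF d).1, pullback.lift_fst_assoc]
  · refine cover_ext (y ≫ P.f₀) fun Z z d a h => ?_
    rw [← Category.assoc, hf d z a h, Category.assoc, (hF d).2, ← Category.assoc, ← Category.assoc]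
    congr 1
    exact toUnit_unique _ _
  · refine cover_ext (y ≫ P.f₀) fun Z z d a h => ?_
    refine (H' d Z (z ≫ y) a (by rw [Category.assoc, h])).unique ⟨?_, ?_⟩ ⟨?_, ?_⟩
    · rw [Category.assoc, hgs]
    · rw [Category.assoc, hgt, ← Category.assoc]
      congr 1
      exact toUnit_unique _ _
    · rw [hf d z a h, Category.assoc, (hF d).1, pullback.lift_fst_assoc]
    · rw [hf d z a h, Category.assoc, (hF d).2, ← Category.assoc]
      congr 1
      exact toUnit_unique _ _

end Fibers

end InternalTensors

theorem mainTheorem9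
    {V : Type u} [Category.{v} V] [CartesianMonoidalCategory V] [MonoidalClosed V]
    [HasPullbacks V] [InternalTensors.Extensive.{w} V]
    {C : Type w} [EnrichedCategory V C]
    (𝒢 : ObjectProperty V) (h𝒢 : InternalTensors.IsConservativeFamily 𝒢)
    {A : InternalTensors.InternalCategory V} (P : A ⟶ InternalTensors.internalization V C)
    (hP : InternalTensors.IsInternalDiscreteFibration P)
    (hA : ∀ X : V, 𝒢 X → InternalTensors.HasInternalTensors P X)
    (c : C) (x : 𝟙_ V ⟶ InternalTensors.fiber P c) :
    A.IsInternalTerminal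
        (InternalTensors.InternalCategory.cstDesc (x ≫ InternalTensors.fiberι P c)) ↔
      InternalTensors.IsVTerminal V
        (⟨x ≫ InternalTensors.fiberι P c⟩ : InternalTensors.Und A) := by
  rw [InternalTensors.InternalCategory.isInternalTerminal_iff, InternalTensors.isVTerminal_iff]
  refine ⟨fun h a Y => h Y (toUnit Y ≫ a), fun h => ?_⟩
  refine InternalTensors.existsUnique_of_fiber P fun d => ?_
  -- The object of morphisms from an object of the fibre at `d` to `(c, x)`, over that fibre:
  -- its projection to the fibre has to be invertible.
  have hp := IsPullback.of_hasPullback (lift A.s A.t)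
    (lift (InternalTensors.fiberι P d) (toUnit _ ≫ x ≫ InternalTensors.fiberι P c))
  have key {Y : V} (y : Y ⟶ InternalTensors.fiber P d) (f : Y ⟶ A.obj₁) :
      f ≫ lift A.s A.t = y ≫ lift (InternalTensors.fiberι P d)
          (toUnit _ ≫ x ≫ InternalTensors.fiberι P c) ↔
        f ≫ A.s = y ≫ InternalTensors.fiberι P d ∧
          f ≫ A.t = toUnit Y ≫ x ≫ InternalTensors.fiberι P c := by
    rw [InternalTensors.comp_lift_eq_iff, ← Category.assoc y (toUnit _),
      toUnit_unique (y ≫ toUnit _) (toUnit Y)]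
  refine fun Y y => (existsUnique_congr (key y)).1 ((InternalTensors.isIso_snd_iff hp).1 ?_ Y y)
  refine (h𝒢 _).2 fun X hX => (InternalTensors.bijective_comp_snd_iff hp X).2 fun G => ?_
  refine (existsUnique_congr (key G)).2 ?_
  obtain ⟨e, he⟩ := hA X hX d G
  refine he.existsUnique_leg ?_
  have := h (InternalTensors.InternalCategory.coconeApex e) (𝟙_ V)
  rwa [toUnit_unique (toUnit (𝟙_ V)) (𝟙 _), Category.id_comp, Category.id_comp] at this
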